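/- Let $H\in(0,3/4)$, $T>0$, $\sigma\neq 0$ and $s_0>0$. Let $B=(B_t)_{t\ge 0}$ be a fractional Brownian motion with Hurst parameter $H$, i.e. a continuous centered Gaussian process with $B_0=0$ and $\mathrm{E}(B_sB_t)=\frac12\left(s^{2H}+t^{2H}-|t-s|^{2H}\right)$. Let $S=(S_t)_{0\le t\le T}$ follow the driftless, constant volatility model $$dS_t=\sigma S_t\,dB_t,\qquad S_0=s_0,\qquad 0\le t\le T,$$ in the Wick–Itô–Skorohod sense. This means that each $S_t$ is a square-integrable functional of $B$ and that $S_t-s_0=\int_0^t\sigma S_u\diamond\frac{dB_u}{du}\,du$, where the Wick product $\diamond$, the white noise $\frac{dB_u}{du}$ and the integral are understood through the $S$-transform $X\mapsto \mathrm{E}\left[X\exp\left(\xi-\tfrac12\mathrm{Var}\,\xi\right)\right]$, $\xi$ ranging over the finite linear combinations of the $B_r$, $r\ge0$: for every such $\xi$ and every $t\in[0,T]$, $$\mathrm{E}\left[(S_t-s_0)e^{\xi-\frac12\mathrm{Var}\,\xi}\right]=\int_0^t \mathrm{E}\left[\sigma S_u e^{\xi-\frac12\mathrm{Var}\,\xi}\right]\frac{d}{du}\mathrm{E}\left[B_u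 e^{\xi-\frac12\mathrm{Var}\,\xi}\right]du .$$ For $N\ge1$ put $h=T/N$ and $$\hat\sigma^2=\frac{1}{Nh^{2H}}\sum_{k=0}^{N-1}\left(\log S_{(k+1)h}-\log S_{kh}\right)^2 .$$ Then, as $N\to\infty$, $$\sqrt N\,(\hat\sigma^2-\sigma^2)\Longrightarrow\mathcal N(0,\sigma^2_{H,2}),$$ where, with $\rho_k=\frac12\left(|k+1|^{2H}+|k-1|^{2H}-2|k|^{2H}\right)$ the correlations of the increments of $B$ over intervals of equal length, the series and the limit below converge and $$\sigma^2_{H,2}=2\sigma^4\sum_{k\in\mathbb Z}\rho_k^2=2\sigma^4\lim_{N\to\infty}\left(1+2\left(1-\tfrac1N\right)\left(2^{2H-1}-1\right)^2+\tfrac12\sum_{k=2}^{N}\left(1-\tfrac kN\right)\left[(k+1)^{2H}+(k-1)^{2H}-2k^{2H}\right]^2\right).$$ -/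

import Mathlib

open MeasureTheory ProbabilityTheory Filter Topology
open scoped NNReal ENNReal

noncomputable section

namespace FBMVolatility

/-- `B` is a fractional Brownian motion with Hurst parameter `H` under `P`: a centered Gaussian
process indexed by `[0, ∞)`, started at `0`, with continuous paths and covariance
`(s ^ (2H) + t ^ (2H) - |t - s| ^ (2H)) / 2`. -/
structure IsFractionalBrownianMotion {Ω : Type*} {mΩ : MeasurableSpace Ω} (H : ℝ)
    (B : ℝ≥0 → Ω → ℝ) (P : Measure Ω) : Prop where
  measurable : ∀ t, Measurable (B t)
  isGaussianProcess : IsGaussianProcess B P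
  centered : ∀ t, ∫ ω, B t ω ∂P = 0
  covariance_eq : ∀ s t : ℝ≥0,
    cov[B s, B t; P] = ((s : ℝ) ^ (2 * H) + (t : ℝ) ^ (2 * H) - |(t : ℝ) - s| ^ (2 * H)) / 2
  start_zero : ∀ᵐ ω ∂P, B 0 ω = 0
  continuous_paths : ∀ᵐ ω ∂P, Continuous fun t => B t ω

/-- The `σ`-algebra generated by all the values of the process `B`. -/
@[reducible] def sigmaAlgebra {Ω : Type*} (B : ℝ≥0 → Ω → ℝ) : MeasurableSpace Ω :=
  ⨆ t, MeasurableSpace.comap (B t) inferInstance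

/-- `X` is a square-integrable functional of the process `B`, that is, up to a null set it is
measurable with respect to the `σ`-algebra of `B`, and it belongs to `L²(P)`. -/
structure IsL2Functional {Ω : Type*} {mΩ : MeasurableSpace Ω} (B : ℝ≥0 → Ω → ℝ) (P : Measure Ω)
    (X : Ω → ℝ) : Prop where
  measurable_of : AEStronglyMeasurable[sigmaAlgebra B] X P
  memLp : MemLp X 2 P

/-- The element `∑ᵢ cᵢ B(tᵢ)` of the first chaos of `B`. -/
def firstChaos {Ω : Type*} (B : ℝ≥0 → Ω → ℝ) (c : ℝ≥0 →₀ ℝ) (ω : Ω) : ℝ :=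
  c.sum fun t a => a * B t ω

/-- The Wick exponential `exp (ξ - Var ξ / 2)` of `ξ = ∑ᵢ cᵢ B(tᵢ)`. -/
def wickExp {Ω : Type*} {mΩ : MeasurableSpace Ω} (B : ℝ≥0 → Ω → ℝ) (P : Measure Ω)
    (c : ℝ≥0 →₀ ℝ) (ω : Ω) : ℝ :=
  Real.exp (firstChaos B c ω - Var[firstChaos B c; P] / 2)

/-- The `S`-transform of `X`: the pairing of `X` with the Wick exponentials. These are total in
`L²` of the `σ`-algebra of `B`, and the `S`-transform of a Wick product is the product of the
`S`-transforms. -/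
def sTransform {Ω : Type*} {mΩ : MeasurableSpace Ω} (B : ℝ≥0 → Ω → ℝ) (P : Measure Ω)
    (X : Ω → ℝ) (c : ℝ≥0 →₀ ℝ) : ℝ :=
  ∫ ω, X ω * wickExp B P c ω ∂P

/-- `Φ` is the Wick-Itô-Skorohod integral `∫₀ᵗ X_s dB_s = ∫₀ᵗ X_s ⋄ (dB_s/ds) ds`, for a fractional
Brownian motion `B`, with `⋄` the Wick product and `dB_s/ds` the fractional white noise. Both are
read through the `S`-transform: that of `dB_s/ds` is the derivative in `s` of that of `B_s`. -/
structure IsWickItoIntegral {Ω : Type*} {mΩ : MeasurableSpace Ω} (B : ℝ≥0 → Ω → ℝ)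
    (P : Measure Ω) (X : ℝ≥0 → Ω → ℝ) (t : ℝ≥0) (Φ : Ω → ℝ) : Prop where
  integrand : ∀ s ≤ t, IsL2Functional B P (X s)
  integral : IsL2Functional B P Φ
  intervalIntegrable : ∀ c : ℝ≥0 →₀ ℝ,
    IntervalIntegrable (fun s : ℝ => sTransform B P (X s.toNNReal) c *
      deriv (fun r : ℝ => sTransform B P (B r.toNNReal) c) s) volume 0 t
  sTransform_eq : ∀ c : ℝ≥0 →₀ ℝ,
    sTransform B P Φ c = ∫ s in (0 : ℝ)..t, sTransform B P (X s.toNNReal) c *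
      deriv (fun r : ℝ => sTransform B P (B r.toNNReal) c) s

/-- `S` solves, on `[0, T]`, the driftless stock price equation with constant volatility
`dS_t = σ S_t dB_t`, `S_0 = s₀`, in the Wick-Itô-Skorohod sense:
`S_t - s₀ = ∫₀ᵗ σ S_u dB_u` for every `t ∈ [0, T]`. -/
structure IsStockPrice {Ω : Type*} {mΩ : MeasurableSpace Ω} (B : ℝ≥0 → Ω → ℝ)
    (P : Measure Ω) (T : ℝ≥0) (σ s₀ : ℝ) (S : ℝ≥0 → Ω → ℝ) : Prop where
  initial : ∀ᵐ ω ∂P, S 0 ω = s₀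
  equation : ∀ t ≤ T,
    IsWickItoIntegral B P (fun u ω => σ * S u ω) t (fun ω => S t ω - s₀)

/-- The estimator `(N h ^ (2H))⁻¹ ∑_{k < N} (log S_{(k+1)h} - log S_{kh})²` of `σ²`, from the
observations of `S` at the times `k h`, with step `h = T / N`. -/
def volEstimator {Ω : Type*} (H : ℝ) (T : ℝ≥0) (S : ℝ≥0 → Ω → ℝ) (N : ℕ) (ω : Ω) : ℝ :=
  1 / ((N : ℝ) * ((T : ℝ) / N) ^ (2 * H)) *
    ∑ k ∈ Finset.range N,
      (Real.log (S (((k : ℝ≥0) + 1) * (T / N)) ω) - Real.log (S ((k : ℝ≥0) * (T / N)) ω)) ^ 2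

/-- The correlation `(|k+1| ^ (2H) + |k-1| ^ (2H) - 2 |k| ^ (2H)) / 2` of two increments of
fractional Brownian motion over intervals of equal length whose starting points are `|k|` lengths
apart. -/
def incrementCorr (H : ℝ) (k : ℤ) : ℝ :=
  (|(k : ℝ) + 1| ^ (2 * H) + |(k : ℝ) - 1| ^ (2 * H) - 2 * |(k : ℝ)| ^ (2 * H)) / 2

end FBMVolatility

end

/-!
The `S`-transform of the Wick-Itô-Skorohod equation at an element `ξ` of the first chaos is a linear
integral equation driven by `t ↦ cov(B_t, ξ)`, which is continuous and, off finitely many times,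
continuously differentiable. Its only solution is `s₀ exp (σ cov(B_t, ξ))`, the `S`-transform of
`s₀` times the Wick exponential of `σ B_t`. Since an `S`-transform determines a square-integrable
functional of `B` (`ae_eq_zero_of_sTransform_eq_zero`), almost surely
`S_t = s₀ exp (σ B_t - σ² t ^ (2H) / 2)` (`IsStockPrice.ae_eq`).

With `X_i` the increments of `B` divided by `h ^ H`, a stationary Gaussian sequence with
correlations `ρ_k`, the normalised error of the estimator is therefore
`σ² N ^ (-1/2) ∑ (X_i² - 1)` plus an error produced by the drift `- σ² t ^ (2H) / 2`
(`IsStockPrice.volEstimator_ae_eq`). Everything rests on `∑ ρ_k² < ∞`, which is where `H < 3/4`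
enters, through `ρ_k = O(|k| ^ (2H - 2))`.

* Diagonalising the covariance matrix of `(X_0, …, X_{N-1})` turns `∑ (X_i² - 1)` into a sum of
  independent copies of `Z² - 1`, with `Z` standard Gaussian, weighted by the eigenvalues. The
  squares of the eigenvalues add up to `∑_{i,j} ρ_{i-j}² ∼ N ∑_k ρ_k²`, and each eigenvalue is at
  most an absolute row sum of the matrix (Gershgorin), hence `o(√N)` as `ρ` is square-summable. So
  the characteristic functions converge (`tendstoInDistribution_sum_sq`).
* The drift error tends to `0` in probability because
  `N ^ (-2H - 1/2) ∑_{i < N} ((i + 1) ^ (2H) - i ^ (2H))² → 0`, again by `H < 3/4`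
  (`tendstoInMeasure_driftError`); Slutsky's theorem concludes.
-/

noncomputable section

namespace FBMVolatility

/-! ### Sums along Toeplitz matrices -/

lemma sum_Icc_one_eq_sum_range (g : ℕ → ℝ) (N : ℕ) :
    ∑ k ∈ Finset.Icc 1 N, g k = ∑ k ∈ Finset.range N, g (k + 1) := by
  induction N with
  | zero => simp
  | succ N ih => rw [Finset.sum_Icc_succ_top (by omega), ih, Finset.sum_range_succ]

lemma sum_range_reflect_int (f : ℤ → ℝ) (N : ℕ) :
    ∑ i ∈ Finset.range N, f ((N : ℤ) - i) = ∑ k ∈ Finset.Icc 1 N, f k := by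
  rw [← Finset.sum_range_reflect, sum_Icc_one_eq_sum_range (fun k => f k)]
  refine Finset.sum_congr rfl fun i hi => ?_
  rw [Finset.mem_range] at hi
  congr 1
  omega

/-- Both sides grow by `f 0 + 2 ∑_{1 ≤ k ≤ N} f k` from `N` to `N + 1`. -/
lemma sum_sum_toeplitz (f : ℤ → ℝ) (hf : ∀ k, f (-k) = f k) (N : ℕ) :
    ∑ i ∈ Finset.range N, ∑ j ∈ Finset.range N, f ((i : ℤ) - j) =
      N * f 0 + 2 * ∑ k ∈ Finset.Icc 1 N, ((N : ℝ) - k) * f k := by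
  induction N with
  | zero => simp
  | succ N ih =>
    have h1 : ∑ i ∈ Finset.range N, f ((i : ℤ) - N) = ∑ k ∈ Finset.Icc 1 N, f k := by
      rw [← sum_range_reflect_int]
      exact Finset.sum_congr rfl fun i _ => by rw [← hf]; congr 1; ring
    simp only [Finset.sum_range_succ, Finset.sum_add_distrib, ih, h1, sum_range_reflect_int]
    rw [Finset.sum_Icc_succ_top (by omega)]
    have h2 : ∑ k ∈ Finset.Icc 1 N, (((N + 1 : ℕ) : ℝ) - k) * f k =
        ∑ k ∈ Finset.Icc 1 N, ((N : ℝ) - k) * f k + ∑ k ∈ Finset.Icc 1 N, f k := by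
      rw [← Finset.sum_add_distrib]
      exact Finset.sum_congr rfl fun i _ => by push_cast; ring
    rw [h2]
    push_cast
    simp
    ring

/-- The weighted partial sums are the Cesàro means of the symmetric partial sums
`∑_{|k| ≤ i} f k`. -/
lemma tendsto_toeplitz_mean (f : ℤ → ℝ) (hf : ∀ k, f (-k) = f k) (hs : Summable f) :
    Tendsto (fun N : ℕ => f 0 + 2 * ∑ k ∈ Finset.Icc 1 N, (1 - (k : ℝ) / N) * f k) atTop
      (𝓝 (∑' k, f k)) := by
  have hs' : Summable fun n : ℕ => f (n + 1) := by
    have := (hs.comp_injective Nat.cast_injective)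
    exact_mod_cast (summable_nat_add_iff (f := fun n : ℕ => f n) 1).2 this
  have hL : ∑' k, f k = f 0 + 2 * ∑' n : ℕ, f (n + 1) := by
    have h := (HasSum.of_nat_of_neg_add_one (f := f)
      (hs.comp_injective (i := fun n : ℕ => (n : ℤ)) Nat.cast_injective).hasSum
      (m' := ∑' n : ℕ, f (n + 1)) (by
        have e : (fun n : ℕ => f (-((n : ℤ) + 1))) = fun n : ℕ => f (n + 1) :=
          funext fun n => hf _
        rw [e]
        exact hs'.hasSum)).tsum_eq
    rw [h, Summable.tsum_eq_zero_add (hs.comp_injective (i := fun n : ℕ => (n : ℤ))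
      Nat.cast_injective)]
    simp only [Function.comp_apply]
    push_cast
    ring
  rw [hL]
  have h1 : Tendsto (fun N : ℕ => f 0 + 2 * ∑ k ∈ Finset.range N, f (k + 1)) atTop
      (𝓝 (f 0 + 2 * ∑' n : ℕ, f (n + 1))) :=
    (hs'.hasSum.tendsto_sum_nat.const_mul 2).const_add _
  have h2 := h1.cesaro
  refine h2.congr' ?_
  filter_upwards [eventually_gt_atTop 0] with N hN
  have hN' : (N : ℝ) ≠ 0 := by positivity
  have key : ∀ M : ℕ, ∑ i ∈ Finset.range M, (f 0 + 2 * ∑ k ∈ Finset.range i, f (k + 1)) =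
      M * f 0 + 2 * ∑ k ∈ Finset.Icc 1 M, ((M : ℝ) - k) * f k := by
    intro M
    induction M with
    | zero => simp
    | succ M ih =>
      rw [Finset.sum_range_succ, ih, Finset.sum_Icc_succ_top (by omega)]
      have h2 : ∑ k ∈ Finset.Icc 1 M, (((M + 1 : ℕ) : ℝ) - k) * f k =
          ∑ k ∈ Finset.Icc 1 M, ((M : ℝ) - k) * f k + ∑ k ∈ Finset.range M, f (k + 1) := by
        have : ∑ k ∈ Finset.range M, f (k + 1) = ∑ k ∈ Finset.Icc 1 M, f k := by
          rw [sum_Icc_one_eq_sum_range (fun k => f k)]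
          push_cast
          rfl
        rw [this, ← Finset.sum_add_distrib]
        exact Finset.sum_congr rfl fun i _ => by push_cast; ring
      rw [h2]
      push_cast
      simp
      ring
  rw [key, mul_add, ← mul_assoc, inv_mul_cancel₀ hN', one_mul, mul_left_comm, Finset.mul_sum]
  congr 2
  refine Finset.sum_congr rfl fun k _ => ?_
  field_simp

lemma tendsto_toeplitz_sum_div (f : ℤ → ℝ) (hf : ∀ k, f (-k) = f k) (hs : Summable f) :
    Tendsto (fun N : ℕ => (∑ i : Fin N, ∑ j : Fin N, f ((i : ℤ) - j)) / N) atTop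
      (𝓝 (∑' k, f k)) := by
  refine (tendsto_toeplitz_mean f hf hs).congr' ?_
  filter_upwards [eventually_gt_atTop 0] with N hN
  have hN' : (N : ℝ) ≠ 0 := by positivity
  have h := sum_sum_toeplitz f hf N
  rw [Fin.sum_univ_eq_sum_range (fun i => ∑ j : Fin N, f ((i : ℤ) - j))]
  simp_rw [fun i : ℕ => Fin.sum_univ_eq_sum_range (fun j => f ((i : ℤ) - j)) N]
  rw [h, add_div, mul_div_cancel_left₀ _ hN', mul_div_assoc, Finset.sum_div]
  congr 2
  refine Finset.sum_congr rfl fun k _ => ?_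
  field_simp

/-- The absolute row sums of the Toeplitz matrix of a square-summable sequence are `o(√N)`: a
finite part of the sequence contributes a constant, and the Cauchy-Schwarz inequality bounds the
rest. -/
lemma exists_toeplitz_row_le (f : ℤ → ℝ) (hs : Summable fun k => f k ^ 2) {ε : ℝ} (hε : 0 < ε) :
    ∃ K : ℝ, ∀ (N : ℕ) (i : ℤ), ∑ j : Fin N, |f (i - j)| ≤ K + ε * √N := by
  obtain ⟨s, hs'⟩ := (summable_iff_vanishing_norm.1 hs) (ε ^ 2) (by positivity)
  refine ⟨∑ k ∈ s, |f k|, fun N i => ?_⟩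
  have hinj : Function.Injective fun j : Fin N => i - (j : ℤ) := by
    intro a b h
    ext
    simp only [sub_right_inj, Nat.cast_inj] at h
    exact h
  rw [← Finset.sum_filter_add_sum_filter_not Finset.univ (fun j : Fin N => i - (j : ℤ) ∈ s)]
  gcongr ?_ + ?_
  · rw [← Finset.sum_image (f := fun k => |f k|) (g := fun j : Fin N => i - (j : ℤ))
      (fun a _ b _ h => hinj h)]
    refine Finset.sum_le_sum_of_subset_of_nonneg ?_ fun _ _ _ => abs_nonneg _
    intro k hk
    simp only [Finset.mem_image, Finset.mem_filter] at hk
    obtain ⟨j, ⟨-, h⟩, rfl⟩ := hk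
    exact h
  · set u := Finset.univ.filter fun j : Fin N => i - (j : ℤ) ∉ s
    have h1 : (∑ j ∈ u, |f (i - j)|) ^ 2 ≤ (ε * √N) ^ 2 := by
      calc (∑ j ∈ u, |f (i - j)|) ^ 2 ≤ u.card * ∑ j ∈ u, |f (i - j)| ^ 2 :=
            sq_sum_le_card_mul_sum_sq
        _ ≤ N * ε ^ 2 := by
            gcongr
            · simpa using Finset.card_le_univ u
            · have h2 := hs' (u.image fun j : Fin N => i - (j : ℤ)) (by
                rw [Finset.disjoint_left]
                intro k hk
                simp only [u, Finset.mem_image, Finset.mem_filter] at hk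
                obtain ⟨j, ⟨-, h⟩, rfl⟩ := hk
                exact h)
              rw [Finset.sum_image (fun a _ b _ h => hinj h)] at h2
              simp only [sq_abs]
              exact (le_abs_self _).trans h2.le
        _ = (ε * √N) ^ 2 := by rw [mul_pow, Real.sq_sqrt (by positivity)]; ring
    exact le_of_sq_le_sq h1 (by positivity)

/-! ### Correlations of the increments -/

lemma incrementCorr_neg (H : ℝ) (k : ℤ) : incrementCorr H (-k) = incrementCorr H k := by
  have h1 : |-(k : ℝ) + 1| = |(k : ℝ) - 1| := by rw [← abs_neg]; congr 1; ring
  have h2 : |-(k : ℝ) - 1| = |(k : ℝ) + 1| := by rw [← abs_neg]; congr 1; ring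
  simp only [incrementCorr, Int.cast_neg, h1, h2, abs_neg]
  ring

lemma incrementCorr_zero {H : ℝ} (hH : 0 < H) : incrementCorr H 0 = 1 := by
  simp [incrementCorr, Real.zero_rpow (by positivity : 2 * H ≠ 0)]

lemma incrementCorr_natCast (H : ℝ) {k : ℕ} (hk : 1 ≤ k) :
    incrementCorr H k =
      (((k : ℝ) + 1) ^ (2 * H) + ((k : ℝ) - 1) ^ (2 * H) - 2 * (k : ℝ) ^ (2 * H)) / 2 := by
  have : (1 : ℝ) ≤ k := by exact_mod_cast hk
  simp only [incrementCorr, Int.cast_natCast]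
  rw [abs_of_nonneg (by linarith), abs_of_nonneg (by linarith), abs_of_nonneg (by linarith)]

/-- The second difference of `x ↦ x ^ p` is of the order of its second derivative, by the mean
value theorem applied twice. -/
lemma abs_second_difference_rpow_le {p x : ℝ} (hp : 0 ≤ p) (hp2 : p ≤ 2) (hx : 1 < x) :
    |(x + 1) ^ p + (x - 1) ^ p - 2 * x ^ p| ≤ p * |p - 1| * (x - 1) ^ (p - 2) := by
  have hd : ∀ y ∈ Set.Icc (x - 1) x, |(y + 1) ^ (p - 1) - y ^ (p - 1)| ≤
      |p - 1| * (x - 1) ^ (p - 2) := by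
    intro y hy
    have hy0 : 0 < y := by linarith [hy.1]
    have h := (convex_Icc y (y + 1)).norm_image_sub_le_of_norm_hasDerivWithin_le
      (f := fun z : ℝ => z ^ (p - 1)) (f' := fun z => (p - 1) * z ^ (p - 1 - 1))
      (C := |p - 1| * (x - 1) ^ (p - 2)) (x := y) (y := y + 1)
      (fun z hz => (Real.hasDerivAt_rpow_const
        (Or.inl (lt_of_lt_of_le hy0 hz.1).ne')).hasDerivWithinAt)
      (fun z hz => by
        have hz0 : 0 < z := by linarith [hz.1]
        rw [norm_mul, Real.norm_eq_abs, Real.norm_of_nonneg (by positivity)]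
        gcongr ?_ * ?_
        rw [show p - 1 - 1 = p - 2 by ring]
        exact Real.rpow_le_rpow_of_nonpos (by linarith) (by linarith [hy.1, hz.1]) (by linarith))
      (Set.left_mem_Icc.2 (by linarith)) (Set.right_mem_Icc.2 (by linarith))
    simpa using h
  have h := (convex_Icc (x - 1) x).norm_image_sub_le_of_norm_hasDerivWithin_le
      (f := fun z : ℝ => (z + 1) ^ p - z ^ p)
      (f' := fun z => p * (z + 1) ^ (p - 1) - p * z ^ (p - 1))
      (C := p * |p - 1| * (x - 1) ^ (p - 2)) (x := x - 1) (y := x)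
      (fun z hz => by
        have hz0 : 0 < z := by linarith [hz.1]
        have h1 : HasDerivAt (fun z : ℝ => (z + 1) ^ p) (p * (z + 1) ^ (p - 1)) z := by
          simpa using ((hasDerivAt_id z).add_const 1).rpow_const (p := p)
            (Or.inl (by simp; linarith))
        exact (h1.sub (Real.hasDerivAt_rpow_const (Or.inl hz0.ne'))).hasDerivWithinAt)
      (fun z hz => by
        rw [← mul_sub, norm_mul, Real.norm_of_nonneg hp, mul_assoc]
        gcongr
        exact hd z hz)
      (Set.left_mem_Icc.2 (by linarith)) (Set.right_mem_Icc.2 (by linarith))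
  rw [Real.norm_eq_abs] at h
  simp only [sub_add_cancel, sub_sub_cancel, norm_one, mul_one] at h
  convert h using 2
  ring

lemma summable_incrementCorr_sq {H : ℝ} (hH₀ : 0 < H) (hH₁ : H < 3 / 4) :
    Summable fun k : ℤ => incrementCorr H k ^ 2 := by
  have hN : Summable fun k : ℕ => incrementCorr H k ^ 2 := by
    rw [← summable_nat_add_iff 2]
    have hs : Summable fun k : ℕ => (2 * H * |2 * H - 1|) ^ 2 * ((k : ℝ) + 1) ^ (4 * H - 4) := by
      refine Summable.mul_left _ ?_
      have := (summable_nat_add_iff 1).2 (Real.summable_nat_rpow.2 (by linarith : 4 * H - 4 < -1))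
      exact_mod_cast this
    refine Summable.of_nonneg_of_le (fun _ => sq_nonneg _) (fun k => ?_) hs
    rw [incrementCorr_natCast H (by omega), div_pow]
    have hk : (0 : ℝ) ≤ k := Nat.cast_nonneg k
    have h := abs_second_difference_rpow_le (p := 2 * H) (x := ((k + 2 : ℕ) : ℝ)) (by linarith)
      (by linarith) (by push_cast; linarith)
    have h2 := pow_le_pow_left₀ (abs_nonneg _) h 2
    rw [sq_abs] at h2
    refine (div_le_self (sq_nonneg _) (by norm_num)).trans (h2.trans (le_of_eq ?_))
    rw [mul_pow, ← Real.rpow_natCast (_ ^ (2 * H - 2)), ← Real.rpow_mul (by push_cast; linarith)]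
    congr 2
    · push_cast; ring
    · push_cast; ring
  refine Summable.of_nat_of_neg hN ?_
  simpa only [incrementCorr_neg] using hN

/-- The sum of the squared correlations as the limit of the normalised variances
`1 + 2 (1 - 1 / N) ρ₁² + 2 ∑_{2 ≤ k ≤ N} (1 - k / N) ρ_k²`. -/
lemma tendsto_variance_formula {H : ℝ} (hH₀ : 0 < H) (hH₁ : H < 3 / 4) :
    Tendsto (fun N : ℕ =>
          (1 + 2 * (1 - 1 / (N : ℝ)) * ((2 : ℝ) ^ (2 * H - 1) - 1) ^ 2 +
            1 / 2 * ∑ k ∈ Finset.Icc 2 N, (1 - (k : ℝ) / N) *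
              (((k : ℝ) + 1) ^ (2 * H) + ((k : ℝ) - 1) ^ (2 * H) - 2 * (k : ℝ) ^ (2 * H)) ^ 2))
        atTop (𝓝 (∑' k : ℤ, incrementCorr H k ^ 2)) := by
  refine (tendsto_toeplitz_mean _ (fun k => by rw [incrementCorr_neg])
    (summable_incrementCorr_sq hH₀ hH₁)).congr' ?_
  filter_upwards [eventually_ge_atTop 1] with N hN
  rw [incrementCorr_zero hH₀, ← Finset.insert_Icc_succ_left_eq_Icc hN, Finset.sum_insert (by simp),
    mul_add, ← add_assoc, one_pow]
  congr 1
  · have h1 : incrementCorr H ((1 : ℕ) : ℤ) = (2 : ℝ) ^ (2 * H - 1) - 1 := by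
      rw [incrementCorr_natCast H le_rfl, Real.rpow_sub_one (by norm_num)]
      norm_num [Real.zero_rpow (by positivity : 2 * H ≠ 0)]
      ring
    rw [h1]
    push_cast
    ring
  · rw [Finset.mul_sum, Finset.mul_sum]
    refine Finset.sum_congr rfl fun k hk => ?_
    have hk' : 1 ≤ k := by
      have := (Finset.mem_Icc.1 hk).1
      omega
    rw [incrementCorr_natCast H hk']
    ring

/-! ### The drift of the logarithm -/

/-- The increments of `x ↦ x ^ p` are at most `1` when `p ≤ 1`, and at most `p n ^ (p - 1)` on
`[0, n]` when `p ≥ 1`. -/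
lemma rpow_increment_le {p : ℝ} (hp : 0 < p) (hp2 : p ≤ 2) {k n : ℕ} (hk : k < n) :
    ((k : ℝ) + 1) ^ p - (k : ℝ) ^ p ≤ 2 * (1 + (n : ℝ) ^ (p - 1)) := by
  have hk0 : (0 : ℝ) ≤ k := Nat.cast_nonneg k
  have hkn : (k : ℝ) + 1 ≤ n := by exact_mod_cast hk
  have hn0 : (0 : ℝ) ≤ (n : ℝ) ^ (p - 1) := by positivity
  rcases le_total p 1 with h | h
  · have := Real.rpow_add_le_add_rpow hk0 zero_le_one hp.le h
    rw [Real.one_rpow] at this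
    linarith
  · have h1 := (convex_Icc (k : ℝ) (k + 1)).norm_image_sub_le_of_norm_hasDerivWithin_le
      (f := fun z : ℝ => z ^ p) (f' := fun z => p * z ^ (p - 1))
      (C := 2 * (n : ℝ) ^ (p - 1)) (x := (k : ℝ)) (y := k + 1)
      (fun z hz => (Real.hasDerivAt_rpow_const (Or.inr h)).hasDerivWithinAt)
      (fun z hz => by
        have hz0 : 0 ≤ z := by linarith [hz.1]
        rw [Real.norm_of_nonneg (by positivity)]
        gcongr
        exact hz.2.trans hkn)
      (Set.left_mem_Icc.2 (by linarith)) (Set.right_mem_Icc.2 (by linarith))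
    have h2 := (le_abs_self _).trans h1
    simp only [add_sub_cancel_left, norm_one, mul_one] at h2
    linarith

lemma tendsto_sum_sq_rpow_increment {p : ℝ} (hp : 0 < p) (hp2 : p < 3 / 2) :
    Tendsto (fun N : ℕ => (∑ k ∈ Finset.range N, (((k : ℝ) + 1) ^ p - (k : ℝ) ^ p) ^ 2) /
      (N : ℝ) ^ (p + 1 / 2)) atTop (𝓝 0) := by
  have hlim : Tendsto (fun N : ℕ => 2 * ((N : ℝ) ^ (-(1 / 2) : ℝ) + (N : ℝ) ^ (-(3 / 2 - p))))
      atTop (𝓝 0) := by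
    have := ((tendsto_rpow_neg_atTop (by norm_num : (0 : ℝ) < 1 / 2)).comp
      tendsto_natCast_atTop_atTop).add ((tendsto_rpow_neg_atTop
        (by linarith : 0 < 3 / 2 - p)).comp tendsto_natCast_atTop_atTop)
    simpa using this.const_mul 2
  refine squeeze_zero' (Eventually.of_forall fun N => by positivity) ?_ hlim
  filter_upwards [eventually_gt_atTop 0] with N hN
  have hN0 : (0 : ℝ) < N := by exact_mod_cast hN
  rw [div_le_iff₀ (by positivity)]
  have hmono : ∀ k : ℕ, 0 ≤ ((k : ℝ) + 1) ^ p - (k : ℝ) ^ p := fun k => by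
    have : (k : ℝ) ^ p ≤ ((k : ℝ) + 1) ^ p := by gcongr; linarith
    linarith
  calc ∑ k ∈ Finset.range N, (((k : ℝ) + 1) ^ p - (k : ℝ) ^ p) ^ 2
      ≤ ∑ k ∈ Finset.range N, 2 * (1 + (N : ℝ) ^ (p - 1)) * (((k : ℝ) + 1) ^ p - (k : ℝ) ^ p) := by
        refine Finset.sum_le_sum fun k hk => ?_
        rw [sq]
        exact mul_le_mul_of_nonneg_right
          (rpow_increment_le hp (by linarith) (Finset.mem_range.1 hk)) (hmono k)
    _ = 2 * (1 + (N : ℝ) ^ (p - 1)) * (N : ℝ) ^ p := by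
        rw [← Finset.mul_sum]
        have := Finset.sum_range_sub (fun k : ℕ => (k : ℝ) ^ p) N
        push_cast at this
        rw [this, Real.zero_rpow hp.ne', sub_zero]
    _ = 2 * ((N : ℝ) ^ (-(1 / 2) : ℝ) + (N : ℝ) ^ (-(3 / 2 - p))) * (N : ℝ) ^ (p + 1 / 2) := by
        have e1 : (N : ℝ) ^ (-(1 / 2) : ℝ) * (N : ℝ) ^ (p + 1 / 2) = (N : ℝ) ^ p := by
          rw [← Real.rpow_add hN0]; congr 1; ring
        have e2 : (N : ℝ) ^ (-(3 / 2 - p)) * (N : ℝ) ^ (p + 1 / 2) =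
            (N : ℝ) ^ (p - 1) * (N : ℝ) ^ p := by
          rw [← Real.rpow_add hN0, ← Real.rpow_add hN0]; congr 1; ring
        linear_combination (-2) * e1 - 2 * e2

/-! ### A central limit theorem for the squared norm of a Gaussian vector -/

/-- The standard Gaussian law has fourth moment `3`, the fourth derivative of `exp (t² / 2)` at
`0`. -/
lemma integral_pow_four_gaussianReal : ∫ x, x ^ 4 ∂(gaussianReal 0 1) = 3 := by
  have h := iteratedDeriv_mgf_zero (X := fun x : ℝ => x) (μ := gaussianReal 0 1) (by simp) 4
  have h4 : ∫ x, x ^ 4 ∂(gaussianReal 0 1) =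
      ∫ x, ((fun x : ℝ => x) ^ 4) x ∂(gaussianReal 0 1) := by simp
  rw [h4, ← h, mgf_fun_id_gaussianReal]
  have hd : ∀ (p p' : ℝ → ℝ), (∀ t, HasDerivAt p (p' t) t) →
      deriv (fun t => p t * Real.exp (t ^ 2 / 2)) =
        fun t => (p' t + t * p t) * Real.exp (t ^ 2 / 2) := by
    intro p p' hp
    ext t
    have h1 : HasDerivAt (fun t : ℝ => t ^ 2 / 2) t t := by
      have h := (hasDerivAt_pow 2 t).div_const 2
      norm_num at h
      exact h
    have h2 : HasDerivAt (fun t => p t * Real.exp (t ^ 2 / 2)) _ t := (hp t).mul h1.exp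
    rw [h2.deriv]
    ring
  have e0 : (fun t : ℝ => Real.exp ((0 : ℝ) * t + ((1 : ℝ≥0) : ℝ) * t ^ 2 / 2)) =
      fun t => (fun _ => (1 : ℝ)) t * Real.exp (t ^ 2 / 2) := by
    ext t; simp
  rw [e0, iteratedDeriv_succ', hd _ _ (fun t => hasDerivAt_const t 1), iteratedDeriv_succ',
    hd (fun t => 0 + t * 1) (fun _ => 1) (fun t => by simpa using hasDerivAt_id' t),
    iteratedDeriv_succ',
    hd (fun t => 1 + t * (0 + t * 1)) (fun t => 2 * t) (fun t => by
      simpa [← sq] using (hasDerivAt_pow 2 t).const_add 1), iteratedDeriv_succ',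
    hd (fun t => 2 * t + t * (1 + t * (0 + t * 1))) (fun t => 3 + 3 * t ^ 2) (fun t => by
      have h1 := ((hasDerivAt_id t).const_mul 3).add (hasDerivAt_pow 3 t)
      refine (h1.congr_deriv (by simp)).congr_of_eventuallyEq (Eventually.of_forall fun t => ?_)
      simp only [Pi.add_apply, id]
      ring)]
  simp

lemma integral_sq_gaussianReal : ∫ x, x ^ 2 ∂(gaussianReal 0 1) = 1 := by
  have h := variance_id_gaussianReal (μ := 0) (v := 1)
  rw [variance_eq_sub (memLp_id_gaussianReal (μ := 0) (v := 1) 2)] at h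
  simpa using h

lemma integrable_pow_gaussianReal (n : ℕ) : Integrable (fun x => x ^ n) (gaussianReal 0 1) :=
  integrable_pow_of_mem_interior_integrableExpSet (X := fun x : ℝ => x) (by simp) n

/-- The characteristic function of `Z² - 1` for a standard Gaussian `Z`. -/
def charFunSqSubOne (t : ℝ) : ℂ :=
  charFun ((gaussianReal 0 1).map fun x => x ^ 2 - 1) t

lemma norm_charFunSqSubOne_le (t : ℝ) : ‖charFunSqSubOne t‖ ≤ 1 := by
  have : IsProbabilityMeasure ((gaussianReal 0 1).map fun x : ℝ => x ^ 2 - 1) :=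
    Measure.isProbabilityMeasure_map (by fun_prop)
  exact norm_charFun_le_one t

lemma norm_exp_neg_sq_le (t : ℝ) : ‖Complex.exp (-(t : ℂ) ^ 2)‖ ≤ 1 := by
  rw [Complex.norm_exp, Real.exp_le_one_iff]
  have : (-(t : ℂ) ^ 2).re = -t ^ 2 := by norm_cast
  rw [this]
  nlinarith [sq_nonneg t]

/-- `Z² - 1` is centered with variance `2`, so that its characteristic function and that of
`N(0, 2)` agree to second order. -/
lemma charFunSqSubOne_sub_exp_isLittleO :
    (fun t : ℝ => charFunSqSubOne t - Complex.exp (-(t : ℂ) ^ 2)) =o[𝓝 0] fun t => t ^ 2 := by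
  have i2 := integrable_pow_gaussianReal 2
  have i4 := integrable_pow_gaussianReal 4
  have h2 : √2 ≠ 0 := by positivity
  have key := taylor_charFun_two (P := gaussianReal 0 1) (X := fun x => (√2)⁻¹ * (x ^ 2 - 1))
    (by fun_prop) (by
      rw [integral_const_mul, integral_sub i2 (by simp), integral_sq_gaussianReal]
      simp) (by
      have : ((fun x : ℝ => (√2)⁻¹ * (x ^ 2 - 1)) ^ 2) =
          fun x => 1 / 2 * (x ^ 4 - 2 * x ^ 2 + 1) := by
        ext x
        simp only [Pi.pow_apply, mul_pow, inv_pow]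
        rw [Real.sq_sqrt (by norm_num)]
        ring
      have i42 : Integrable (fun x : ℝ => x ^ 4 - 2 * x ^ 2) (gaussianReal 0 1) :=
        i4.sub (i2.const_mul 2)
      rw [this, integral_const_mul, integral_add i42 (by simp), integral_sub i4 (i2.const_mul 2),
        integral_const_mul, integral_sq_gaussianReal,
        integral_pow_four_gaussianReal]
      simp
      norm_num)
  have hscale : Tendsto (fun t : ℝ => √2 * t) (𝓝 0) (𝓝 0) := by
    have : Continuous fun t : ℝ => √2 * t := by fun_prop
    simpa using this.tendsto 0
  have h1 := key.comp_tendsto hscale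
  have h1' : (fun t : ℝ => charFunSqSubOne t - (1 - (t : ℂ) ^ 2)) =o[𝓝 0] fun t => t ^ 2 := by
    refine (h1.congr' (Eventually.of_forall fun t => ?_)
      (Eventually.of_forall fun t => ?_)).trans_isBigO
      (Asymptotics.isBigO_const_mul_self 2 (fun t : ℝ => t ^ 2) _)
    · simp only [Function.comp_apply]
      rw [charFun_map_mul_comp (by fun_prop), ← mul_assoc, inv_mul_cancel₀ h2, one_mul]
      have : ((√2 * t : ℝ) : ℂ) ^ 2 = 2 * (t : ℂ) ^ 2 := by
        rw [← Complex.ofReal_pow, mul_pow, Real.sq_sqrt (by norm_num)]; push_cast; rfl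
      rw [this, charFunSqSubOne]
      ring
    · simp only [Function.comp_apply, mul_pow]
      rw [Real.sq_sqrt (by norm_num)]
  have h3 : (fun t : ℝ => (1 - (t : ℂ) ^ 2) - Complex.exp (-(t : ℂ) ^ 2)) =o[𝓝 0]
      fun t => t ^ 2 := by
    have hsq : Tendsto (fun t : ℝ => -(t : ℂ) ^ 2) (𝓝 0) (𝓝 0) := by
      have : Continuous fun t : ℝ => -(t : ℂ) ^ 2 := by fun_prop
      simpa using this.tendsto 0
    have h := ((Complex.hasDerivAt_exp 0).isLittleO).comp_tendsto hsq
    refine (h.neg_left.congr' (Eventually.of_forall fun t => ?_) EventuallyEq.rfl).trans_isBigO ?_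
    · simp
      ring
    · refine Asymptotics.IsBigO.of_bound 1 (Eventually.of_forall fun t => ?_)
      simp
  refine (h1'.add h3).congr_left fun t => ?_
  ring

/-- A Lindeberg-type statement: if the coefficients `a N i` are uniformly small and
`∑ᵢ (a N i)² → w`, then `∑ᵢ a N i (Zᵢ² - 1)` has the characteristic function of `N(0, 2 w)` in the
limit. -/
lemma tendsto_prod_charFunSqSubOne {ι : ℕ → Type*} [∀ N, Fintype (ι N)] (a : ∀ N, ι N → ℝ) {w : ℝ}
    (ha : Tendsto (fun N => ∑ i, a N i ^ 2) atTop (𝓝 w))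
    (hsmall : ∀ δ > 0, ∀ᶠ N in atTop, ∀ i, |a N i| < δ) :
    Tendsto (fun N => ∏ i, charFunSqSubOne (a N i)) atTop (𝓝 (Complex.exp (-(w : ℂ)))) := by
  have hexp : Tendsto (fun N => ∏ i, Complex.exp (-(a N i : ℂ) ^ 2)) atTop
      (𝓝 (Complex.exp (-(w : ℂ)))) := by
    have : (fun N => ∏ i, Complex.exp (-(a N i : ℂ) ^ 2)) =
        fun N => Complex.exp (-((∑ i, a N i ^ 2 : ℝ) : ℂ)) := by
      ext N
      rw [← Complex.exp_sum]
      push_cast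
      rw [Finset.sum_neg_distrib]
    rw [this]
    exact ((Complex.continuous_exp.comp (Complex.continuous_ofReal.neg)).tendsto w).comp ha
  suffices hdiff : Tendsto (fun N => ∏ i, charFunSqSubOne (a N i) -
      ∏ i, Complex.exp (-(a N i : ℂ) ^ 2)) atTop (𝓝 0) by
    simpa using hdiff.add hexp
  rw [Metric.tendsto_atTop']
  intro ε hε
  have hc : 0 < ε / (|w| + 2) := by positivity
  have hlo := charFunSqSubOne_sub_exp_isLittleO.def hc
  obtain ⟨δ, hδ, hball⟩ := Metric.eventually_nhds_iff.1 hlo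
  have hev : ∀ᶠ N in atTop, ∑ i, a N i ^ 2 < |w| + 1 :=
    ha.eventually_lt_const (by linarith [le_abs_self w])
  have hall : ∀ᶠ N in atTop, dist (∏ i, charFunSqSubOne (a N i) -
      ∏ i, Complex.exp (-(a N i : ℂ) ^ 2)) 0 < ε := by
    filter_upwards [hev, hsmall δ hδ] with N hN1 hN2
    rw [dist_zero_right]
    have hb : ∀ s : Finset (ι N), ‖∏ i ∈ s, charFunSqSubOne (a N i) -
        ∏ i ∈ s, Complex.exp (-(a N i : ℂ) ^ 2)‖ ≤ ∑ i ∈ s, ε / (|w| + 2) * a N i ^ 2 := by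
      classical
      intro s
      induction s using Finset.induction with
      | empty => simp
      | insert i s hi ih =>
        rw [Finset.prod_insert hi, Finset.prod_insert hi, Finset.sum_insert hi]
        have hi' := hball (y := a N i) (by simpa using hN2 i)
        rw [Real.norm_of_nonneg (sq_nonneg (a N i))] at hi'
        have hp : ‖∏ i ∈ s, charFunSqSubOne (a N i)‖ ≤ 1 := by
          rw [norm_prod]
          exact Finset.prod_le_one (fun _ _ => norm_nonneg _)
            fun _ _ => norm_charFunSqSubOne_le _
        calc ‖charFunSqSubOne (a N i) * ∏ i ∈ s, charFunSqSubOne (a N i) -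
              Complex.exp (-(a N i : ℂ) ^ 2) * ∏ i ∈ s, Complex.exp (-(a N i : ℂ) ^ 2)‖
            = ‖(charFunSqSubOne (a N i) - Complex.exp (-(a N i : ℂ) ^ 2)) *
                ∏ i ∈ s, charFunSqSubOne (a N i) + Complex.exp (-(a N i : ℂ) ^ 2) *
                (∏ i ∈ s, charFunSqSubOne (a N i) -
                  ∏ i ∈ s, Complex.exp (-(a N i : ℂ) ^ 2))‖ := by congr 1; ring
          _ ≤ ‖charFunSqSubOne (a N i) - Complex.exp (-(a N i : ℂ) ^ 2)‖ * 1 + 1 *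
              ‖∏ i ∈ s, charFunSqSubOne (a N i) -
                  ∏ i ∈ s, Complex.exp (-(a N i : ℂ) ^ 2)‖ := by
              refine (norm_add_le _ _).trans ?_
              rw [norm_mul, norm_mul]
              gcongr
              exact norm_exp_neg_sq_le _
          _ ≤ _ := by rw [mul_one, one_mul]; exact add_le_add hi' ih
    refine (hb Finset.univ).trans_lt ?_
    rw [← Finset.mul_sum, div_mul_eq_mul_div, div_lt_iff₀ (by positivity)]
    gcongr
    linarith
  obtain ⟨N₀, h⟩ := eventually_atTop.1 hall
  exact ⟨N₀, fun n hn => h n hn.le⟩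

section QuadraticForm

open scoped Matrix

variable {Ω : Type*} {mΩ : MeasurableSpace Ω} {P : Measure Ω}

/-- The law of `X² - Var X` for a centered Gaussian `X`. -/
lemma charFun_map_sq_sub_variance {X : Ω → ℝ} (hX : HasGaussianLaw X P) (hc : ∫ ω, X ω ∂P = 0)
    (t : ℝ) : charFun (P.map fun ω => X ω ^ 2 - Var[X; P]) t = charFunSqSubOne (Var[X; P] * t) := by
  set v := Var[X; P]
  have hv : 0 ≤ v := variance_nonneg _ _
  have hlaw : P.map X = (gaussianReal 0 1).map fun x => √v * x := by
    rw [hX.map_eq_gaussianReal, gaussianReal_map_const_mul, hc, mul_zero, mul_one]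
    congr 1
    ext
    simp [Real.sq_sqrt hv, hv, v]
  have e1 : P.map (fun ω => X ω ^ 2 - v) =
      (gaussianReal 0 1).map fun x => v * (x ^ 2 - 1) := by
    have : (fun ω => X ω ^ 2 - v) = (fun x => x ^ 2 - v) ∘ X := rfl
    rw [this, ← AEMeasurable.map_map_of_aemeasurable (by fun_prop) hX.aemeasurable, hlaw,
      Measure.map_map (by fun_prop) (by fun_prop)]
    congr 1
    ext x
    simp [mul_pow, Real.sq_sqrt hv]
    ring
  rw [e1, charFun_map_mul_comp (by fun_prop), charFunSqSubOne]

/-- By diagonalisation of the covariance matrix `R`, the centered squared norm of a Gaussian vector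
is a sum of independent copies of `Z² - 1` weighted by the eigenvalues of `R`. The eigenvalues are
bounded by the absolute row sums of `R`. -/
lemma exists_charFun_sum_sq {ι : Type*} [Fintype ι] [DecidableEq ι] {X : ι → Ω → ℝ}
    {R : Matrix ι ι ℝ} (hX : HasGaussianLaw (fun ω i => X i ω) P)
    (hc : ∀ i, ∫ ω, X i ω ∂P = 0) (hR : ∀ i j, cov[X i, X j; P] = R i j) :
    ∃ l : ι → ℝ, ∑ i, l i ^ 2 = ∑ i, ∑ j, R i j ^ 2 ∧ (∀ i, ∃ k, |l i| ≤ ∑ j, |R k j|) ∧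
      ∀ t, charFun (P.map fun ω => ∑ i, (X i ω ^ 2 - R i i)) t =
        ∏ i, charFunSqSubOne (l i * t) := by
  have := hX.isProbabilityMeasure
  have hsymm : ∀ i j, R i j = R j i := fun i j => by rw [← hR, ← hR, covariance_comm]
  have hA : R.IsHermitian := by
    ext i j
    simp [hsymm i j]
  set U : Matrix ι ι ℝ := (hA.eigenvectorUnitary : Matrix ι ι ℝ)
  have hUU : U * Uᵀ = 1 := by
    have := Unitary.coe_mul_star_self hA.eigenvectorUnitary
    rwa [Unitary.coe_star, Matrix.star_eq_conjTranspose,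
      Matrix.conjTranspose_eq_transpose_of_trivial] at this
  have hD : Uᵀ * R * U = Matrix.diagonal hA.eigenvalues := by
    have := hA.conjStarAlgAut_star_eigenvectorUnitary
    rw [Unitary.conjStarAlgAut_star_apply, Matrix.star_eq_conjTranspose,
      Matrix.conjTranspose_eq_transpose_of_trivial] at this
    simpa using this
  have hmem : ∀ i, MemLp (X i) 2 P := fun i => (hX.eval i).memLp_two
  let L : (ι → ℝ) →L[ℝ] (ι → ℝ) := (Matrix.mulVecLin Uᵀ).toContinuousLinearMap
  set Y : ι → Ω → ℝ := fun i ω => ∑ j, U j i * X j ω with hYdef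
  have hY : HasGaussianLaw (fun ω i => Y i ω) P := hX.map_fun L
  have hYc : ∀ i, ∫ ω, Y i ω ∂P = 0 := by
    intro i
    simp only [hYdef]
    rw [integral_finsetSum _ fun j _ => ((hX.eval j).integrable.const_mul _)]
    simp [integral_const_mul, hc]
  have hYcov : ∀ i k, cov[Y i, Y k; P] = Matrix.diagonal hA.eigenvalues i k := by
    intro i k
    rw [← hD]
    simp only [hYdef]
    rw [covariance_fun_sum_fun_sum (fun j => (hmem j).const_mul _) fun j => (hmem j).const_mul _]
    simp only [covariance_const_mul_left, covariance_const_mul_right, hR, Matrix.mul_apply,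
      Matrix.transpose_apply, Finset.sum_mul]
    rw [Finset.sum_comm]
    refine Finset.sum_congr rfl fun a _ => Finset.sum_congr rfl fun b _ => by ring
  have hYvar : ∀ i, Var[Y i; P] = hA.eigenvalues i := fun i => by
    rw [← covariance_self (hY.eval i).aemeasurable, hYcov, Matrix.diagonal_apply_eq]
  have hind : iIndepFun Y P := hY.iIndepFun_of_covariance_eq_zero fun i j hij => by
    rw [hYcov, Matrix.diagonal_apply_ne _ hij]
  have hsumsq : ∀ ω, ∑ i, Y i ω ^ 2 = ∑ i, X i ω ^ 2 := by
    intro ω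
    have h1 : (Uᵀ.mulVec fun j => X j ω) ⬝ᵥ (Uᵀ.mulVec fun j => X j ω) =
        (fun j => X j ω) ⬝ᵥ (fun j => X j ω) := by
      rw [Matrix.dotProduct_mulVec, Matrix.vecMul_transpose, Matrix.mulVec_mulVec, hUU,
        Matrix.one_mulVec]
    simp only [sq]
    exact h1
  have htrace : ∑ i, hA.eigenvalues i = ∑ i, R i i := by
    have h1 : (Uᵀ * R * U).trace = R.trace := by
      rw [Matrix.trace_mul_comm, ← mul_assoc, hUU, one_mul]
    rw [hD, Matrix.trace_diagonal] at h1
    exact h1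
  refine ⟨hA.eigenvalues, ?_, fun i => ?_, fun t => ?_⟩
  · have h1 : ((Uᵀ * R * U) * (Uᵀ * R * U)).trace = (R * R).trace := by
      have : (Uᵀ * R * U) * (Uᵀ * R * U) = Uᵀ * (R * (U * Uᵀ) * R) * U := by
        simp only [mul_assoc]
      rw [this, hUU, mul_one, Matrix.trace_mul_comm, ← mul_assoc, hUU, one_mul]
    rw [hD, Matrix.diagonal_mul_diagonal, Matrix.trace_diagonal] at h1
    simp only [sq]
    rw [h1]
    simp only [Matrix.trace, Matrix.diag, Matrix.mul_apply]
    exact Finset.sum_congr rfl fun a _ => Finset.sum_congr rfl fun b _ => by rw [hsymm b a]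
  · have hev : Module.End.HasEigenvalue (Matrix.toLin' R) (hA.eigenvalues i) := by
      refine Module.End.hasEigenvalue_of_hasEigenvector
        (x := (hA.eigenvectorBasis i : ι → ℝ)) ⟨?_, ?_⟩
      · rw [Module.End.mem_eigenspace_iff, Matrix.toLin'_apply]
        exact hA.mulVec_eigenvectorBasis i
      · intro h0
        have := hA.eigenvectorBasis.toBasis.ne_zero i
        apply this
        ext j
        simpa using congrFun h0 j
    obtain ⟨k, hk⟩ := eigenvalue_mem_ball hev
    refine ⟨k, ?_⟩
    rw [Metric.mem_closedBall, Real.dist_eq] at hk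
    rw [← Finset.add_sum_erase _ _ (Finset.mem_univ k)]
    have := abs_sub_abs_le_abs_sub (hA.eigenvalues i) (R k k)
    simp only [Real.norm_eq_abs] at hk
    linarith
  · have e : (fun ω => ∑ i, (X i ω ^ 2 - R i i)) =
        fun ω => ∑ i, (Y i ω ^ 2 - Var[Y i; P]) := by
      ext ω
      rw [Finset.sum_sub_distrib, Finset.sum_sub_distrib, hsumsq]
      simp only [hYvar, htrace]
    have hind' : iIndepFun (fun i ω => Y i ω ^ 2 - Var[Y i; P]) P :=
      hind.comp (fun i x => x ^ 2 - Var[Y i; P]) fun i => by fun_prop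
    rw [e, hind'.charFun_map_fun_sum_eq_prod fun i =>
      ((hY.eval i).aemeasurable.pow_const 2).sub_const _, Finset.prod_apply]
    exact Finset.prod_congr rfl fun i _ => by
      rw [charFun_map_sq_sub_variance (hY.eval i) (hYc i), hYvar]

/-- A central limit theorem in the second chaos: it requires that the normalised squared
Hilbert-Schmidt norm of the covariance matrices converges and that their operator norms, controlled
by absolute row sums, are `o(√N)`. -/
theorem tendstoInDistribution_sum_sq [IsProbabilityMeasure P] {X : ∀ N : ℕ, Fin N → Ω → ℝ}
    {R : ∀ N : ℕ, Matrix (Fin N) (Fin N) ℝ}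
    (hX : ∀ N, HasGaussianLaw (fun ω i => X N i ω) P) (hc : ∀ N i, ∫ ω, X N i ω ∂P = 0)
    (hR : ∀ N i j, cov[X N i, X N j; P] = R N i j) {w : ℝ≥0}
    (hw : Tendsto (fun N : ℕ => (∑ i, ∑ j, R N i j ^ 2) / N) atTop (𝓝 (w : ℝ)))
    (hrow : ∀ ε > 0, ∃ K : ℝ, ∀ (N : ℕ) (i : Fin N), ∑ j, |R N i j| ≤ K + ε * √N) :
    TendstoInDistribution (fun (N : ℕ) ω => (√N)⁻¹ * ∑ i, (X N i ω ^ 2 - R N i i)) atTop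
      (id : ℝ → ℝ) (fun _ => P) (gaussianReal 0 (2 * w)) where
  forall_aemeasurable N := by
    refine AEMeasurable.const_mul ?_ _
    exact Finset.aemeasurable_fun_sum _ fun i _ =>
      (((hX N).eval i).aemeasurable.pow_const 2).sub_const _
  tendsto := by
    choose l hl1 hl2 hl3 using fun N => exists_charFun_sum_sq (hX N) (hc N) (hR N)
    refine ProbabilityMeasure.tendsto_iff_tendsto_charFun.2 fun t => ?_
    have hmeas : ∀ N, AEMeasurable (fun ω => ∑ i, (X N i ω ^ 2 - R N i i)) P := fun N =>
      Finset.aemeasurable_fun_sum _ fun i _ =>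
        (((hX N).eval i).aemeasurable.pow_const 2).sub_const _
    have hlim := tendsto_prod_charFunSqSubOne (fun N i => l N i * ((√N)⁻¹ * t)) (w := t ^ 2 * w)
      (by
        refine (hw.const_mul (t ^ 2)).congr fun N => ?_
        simp only [mul_pow, ← Finset.sum_mul, hl1, inv_pow]
        rw [Real.sq_sqrt (Nat.cast_nonneg N)]
        ring)
      (by
        intro δ hδ
        obtain ⟨K, hK⟩ := hrow (δ / (2 * (|t| + 1))) (by positivity)
        have h0 : Tendsto (fun N : ℕ => |K| * |t| / √N) atTop (𝓝 0) :=
          Tendsto.const_div_atTop (Real.tendsto_sqrt_atTop.comp tendsto_natCast_atTop_atTop) _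
        filter_upwards [h0.eventually_lt_const (half_pos hδ), eventually_gt_atTop 0] with N hN hN0 i
        have hs : 0 < √(N : ℝ) := Real.sqrt_pos.2 (by exact_mod_cast hN0)
        obtain ⟨k, hk⟩ := hl2 N i
        have h1 : |l N i| ≤ |K| + δ / (2 * (|t| + 1)) * √N :=
          hk.trans ((hK N k).trans (by gcongr; exact le_abs_self K))
        have h2 : δ / (2 * (|t| + 1)) * |t| ≤ δ / 2 := by
          rw [div_mul_eq_mul_div, div_le_div_iff₀ (by positivity) (by positivity)]
          nlinarith [abs_nonneg t]
        rw [abs_mul, abs_mul, abs_inv, abs_of_pos hs]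
        calc |l N i| * ((√N)⁻¹ * |t|)
            ≤ (|K| + δ / (2 * (|t| + 1)) * √N) * ((√N)⁻¹ * |t|) := by gcongr
          _ = |K| * |t| / √N + δ / (2 * (|t| + 1)) * |t| := by field_simp
          _ < δ := by linarith)
    have e : charFun ((gaussianReal 0 (2 * w)).map id) t =
        Complex.exp (-((t ^ 2 * w : ℝ) : ℂ)) := by
      simp only [Measure.map_id, charFun_gaussianReal]
      congr 1
      push_cast
      ring
    have hfin : Tendsto (fun N : ℕ => charFun (P.map fun ω => (√(N : ℝ))⁻¹ *
        ∑ i, (X N i ω ^ 2 - R N i i)) t) atTop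
        (𝓝 (charFun ((gaussianReal 0 (2 * w)).map id) t)) := by
      rw [e]
      refine hlim.congr fun N => ?_
      rw [charFun_map_mul_comp (hmeas N), hl3]
    exact hfin

end QuadraticForm

/-! ### A linear integral equation -/

/-- The solution of `F t = a + ∫₀ᵗ F dG` for a continuous `G` that is continuously differentiable
off a countable set. -/
lemma eq_mul_exp_of_integral_equation {F G : ℝ → ℝ} {a T : ℝ} {s : Set ℝ} (hs : s.Countable)
    (hT : 0 ≤ T) (hG : ContinuousOn G (Set.Icc 0 T))
    (hG' : ∀ x ∈ Set.Ioo 0 T \ s, ContDiffAt ℝ 1 G x)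
    (hint : IntervalIntegrable (fun u => F u * deriv G u) volume 0 T)
    (hF : ∀ t ∈ Set.Icc 0 T, F t = a + ∫ u in (0 : ℝ)..t, F u * deriv G u) :
    F T = a * Real.exp (G T - G 0) := by
  have hcont : ContinuousOn F (Set.Icc 0 T) := by
    have h := intervalIntegral.continuousOn_primitive_interval' hint Set.left_mem_uIcc
    rw [Set.uIcc_of_le hT] at h
    exact (continuousOn_const.add h).congr hF
  have hder : ∀ x ∈ Set.Ioo 0 T \ s, HasDerivAt F (F x * deriv G x) x := by
    intro x hx
    have hx' : Set.Icc 0 T ∈ 𝓝 x := Icc_mem_nhds hx.1.1 hx.1.2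
    have hGc : ContinuousAt (deriv G) x := by
      have h := ((hG' x hx).fderiv_right (m := 0) (by norm_num)).continuousAt
      exact h.clm_apply continuousAt_const
    have hFc : ContinuousAt F x := hcont.continuousAt hx'
    have hint' : IntervalIntegrable (fun u => F u * deriv G u) volume 0 x :=
      hint.mono_set (by
        rw [Set.uIcc_of_le hx.1.1.le, Set.uIcc_of_le hT]
        exact Set.Icc_subset_Icc_right hx.1.2.le)
    have hm : StronglyMeasurableAtFilter (fun u => F u * deriv G u) (𝓝 x) volume :=
      ⟨Set.Ioc 0 T, Ioc_mem_nhds hx.1.1 hx.1.2, ((intervalIntegrable_iff_integrableOn_Ioc_of_le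
        hT).1 hint).aestronglyMeasurable⟩
    have h := (intervalIntegral.integral_hasDerivAt_right hint' hm (hFc.mul hGc)).const_add a
    exact h.congr_of_eventuallyEq (Filter.eventually_of_mem hx' hF)
  -- `F exp (-G)` is continuous with vanishing derivative off a countable set
  have h0 : ∫ x in (0 : ℝ)..T, (0 : ℝ) = F T * Real.exp (-G T) - F 0 * Real.exp (-G 0) := by
    refine integral_eq_of_hasDerivAt_off_countable_of_le (fun x => F x * Real.exp (-G x))
      (fun _ => 0) hT hs (hcont.mul hG.neg.rexp) (fun x hx => ?_) (by simp)
    have hg := ((hG' x hx).differentiableAt (by norm_num)).hasDerivAt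
    exact ((hder x hx).mul hg.neg.exp).congr_deriv (by ring)
  have hF0 : F 0 = a := by simpa using hF 0 (Set.left_mem_Icc.2 hT)
  rw [intervalIntegral.integral_zero, hF0, Real.exp_neg, Real.exp_neg] at h0
  have e1 := Real.exp_pos (G T)
  have e2 := Real.exp_pos (G 0)
  rw [Real.exp_sub]
  field_simp at h0 ⊢
  linarith

/-! ### The first chaos and the Wick exponentials -/

section Gaussian

variable {Ω : Type*} {mΩ : MeasurableSpace Ω} {P : Measure Ω} {B : ℝ≥0 → Ω → ℝ}

lemma firstChaos_add (c d : ℝ≥0 →₀ ℝ) (ω : Ω) :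
    firstChaos B (c + d) ω = firstChaos B c ω + firstChaos B d ω :=
  Finsupp.sum_add_index' (by simp) (by intros; ring)

lemma firstChaos_smul (a : ℝ) (c : ℝ≥0 →₀ ℝ) (ω : Ω) :
    firstChaos B (a • c) ω = a * firstChaos B c ω := by
  rw [firstChaos, Finsupp.sum_smul_index' (by simp), firstChaos, Finsupp.mul_sum]
  simp [mul_assoc]

lemma firstChaos_single (t : ℝ≥0) (a : ℝ) (ω : Ω) :
    firstChaos B (Finsupp.single t a) ω = a * B t ω := by
  simp [firstChaos]

/-- The linear combinations of the values of a Gaussian process form a Gaussian process. -/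
lemma isGaussianProcess_firstChaos (hB : IsGaussianProcess B P) :
    IsGaussianProcess (firstChaos B) P := by
  refine hB.of_isGaussianProcess fun c => ⟨c.support,
    ∑ t : c.support, c t • ContinuousLinearMap.proj (R := ℝ) (φ := fun _ : c.support => ℝ) t,
    fun ω => ?_⟩
  simp only [firstChaos, Finsupp.sum, sum_apply,
    smul_apply, ContinuousLinearMap.proj_apply, smul_eq_mul,
    Finset.restrict_def]
  exact (Finset.sum_coe_sort c.support fun t => c t * B t ω).symm

lemma integral_firstChaos (hB : IsGaussianProcess B P) (hc : ∀ t, ∫ ω, B t ω ∂P = 0)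
    (c : ℝ≥0 →₀ ℝ) : ∫ ω, firstChaos B c ω ∂P = 0 := by
  simp only [firstChaos, Finsupp.sum]
  rw [integral_finsetSum _ fun t _ => (hB.hasGaussianLaw_eval t).integrable.const_mul _]
  simp [integral_const_mul, hc]

lemma memLp_firstChaos (hB : IsGaussianProcess B P) (c : ℝ≥0 →₀ ℝ) :
    MemLp (firstChaos B c) 2 P :=
  ((isGaussianProcess_firstChaos hB).hasGaussianLaw_eval c).memLp_two

lemma map_firstChaos (hB : IsGaussianProcess B P) (hc : ∀ t, ∫ ω, B t ω ∂P = 0)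
    (c : ℝ≥0 →₀ ℝ) :
    P.map (firstChaos B c) = gaussianReal 0 (Var[firstChaos B c; P]).toNNReal := by
  rw [((isGaussianProcess_firstChaos hB).hasGaussianLaw_eval c).map_eq_gaussianReal,
    integral_firstChaos hB hc]

lemma integrable_exp_firstChaos (hB : IsGaussianProcess B P) (hc : ∀ t, ∫ ω, B t ω ∂P = 0)
    (c : ℝ≥0 →₀ ℝ) : Integrable (fun ω => Real.exp (firstChaos B c ω)) P := by
  have h := integrable_exp_mul_gaussianReal (μ := 0) (v := (Var[firstChaos B c; P]).toNNReal) 1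
  rw [← map_firstChaos hB hc c] at h
  have := h.comp_aemeasurable
    ((isGaussianProcess_firstChaos hB).hasGaussianLaw_eval c).aemeasurable
  simpa [Function.comp_def] using this

lemma integral_exp_firstChaos (hB : IsGaussianProcess B P) (hc : ∀ t, ∫ ω, B t ω ∂P = 0)
    (c : ℝ≥0 →₀ ℝ) :
    ∫ ω, Real.exp (firstChaos B c ω) ∂P = Real.exp (Var[firstChaos B c; P] / 2) := by
  have h := mgf_gaussianReal (map_firstChaos hB hc c) 1
  simpa [mgf, Real.coe_toNNReal _ (variance_nonneg _ _)] using h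

lemma variance_firstChaos_add (hB : IsGaussianProcess B P) (c d : ℝ≥0 →₀ ℝ) :
    Var[firstChaos B (c + d); P] = Var[firstChaos B c; P] +
      2 * cov[firstChaos B c, firstChaos B d; P] + Var[firstChaos B d; P] := by
  have := hB.isProbabilityMeasure
  rw [← variance_add (memLp_firstChaos hB c) (memLp_firstChaos hB d)]
  congr 1
  ext ω
  exact firstChaos_add c d ω

lemma variance_firstChaos_smul (a : ℝ) (c : ℝ≥0 →₀ ℝ) :
    Var[firstChaos B (a • c); P] = a ^ 2 * Var[firstChaos B c; P] := by
  rw [← variance_const_mul]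
  congr 1
  ext ω
  exact firstChaos_smul a c ω

lemma memLp_wickExp (hB : IsGaussianProcess B P) (hc : ∀ t, ∫ ω, B t ω ∂P = 0)
    (c : ℝ≥0 →₀ ℝ) : MemLp (wickExp B P c) 2 P := by
  have hm : AEStronglyMeasurable (wickExp B P c) P := by
    have := ((isGaussianProcess_firstChaos hB).hasGaussianLaw_eval c).aemeasurable
    exact (Real.measurable_exp.comp_aemeasurable (this.sub_const _)).aestronglyMeasurable
  rw [memLp_two_iff_integrable_sq hm]
  refine ((integrable_exp_firstChaos hB hc ((2 : ℝ) • c)).mul_const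
    (Real.exp (-Var[firstChaos B c; P]))).congr (Eventually.of_forall fun ω => ?_)
  simp only [firstChaos_smul, wickExp, ← Real.exp_add, sq]
  congr 1
  ring

lemma integral_wickExp (hB : IsGaussianProcess B P) (hc : ∀ t, ∫ ω, B t ω ∂P = 0)
    (c : ℝ≥0 →₀ ℝ) : ∫ ω, wickExp B P c ω ∂P = 1 := by
  simp only [wickExp, Real.exp_sub]
  rw [integral_div, integral_exp_firstChaos hB hc, div_self (Real.exp_pos _).ne']

lemma sTransform_wickExp (hB : IsGaussianProcess B P) (hc : ∀ t, ∫ ω, B t ω ∂P = 0)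
    (c d : ℝ≥0 →₀ ℝ) :
    sTransform B P (wickExp B P d) c = Real.exp (cov[firstChaos B d, firstChaos B c; P]) := by
  have h : ∀ ω, wickExp B P d ω * wickExp B P c ω = Real.exp (firstChaos B (d + c) ω) *
      Real.exp (-(Var[firstChaos B d; P] + Var[firstChaos B c; P]) / 2) := by
    intro ω
    rw [wickExp, wickExp, ← Real.exp_add, ← Real.exp_add, firstChaos_add]
    congr 1
    ring
  simp only [sTransform, h]
  rw [integral_mul_const, integral_exp_firstChaos hB hc, variance_firstChaos_add hB,
    ← Real.exp_add]
  congr 1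
  ring

/-- The `S`-transform of `B_t` at `ξ` is `cov(B_t, ξ)`: under the law tilted by `ξ`, which is the
law with the Wick exponential of `ξ` as density, `B_t` is Gaussian with that mean. -/
lemma sTransform_eval (hB : IsGaussianProcess B P) (hc : ∀ t, ∫ ω, B t ω ∂P = 0)
    (t : ℝ≥0) (c : ℝ≥0 →₀ ℝ) :
    sTransform B P (B t) c = cov[B t, firstChaos B c; P] := by
  set e : ℝ≥0 →₀ ℝ := Finsupp.single t 1 with he
  have hBe : B t = firstChaos B e := by
    ext ω
    simp [he, firstChaos_single]
  rw [hBe]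
  have hexp : ∀ (s : ℝ) ω, Real.exp (firstChaos B c ω) * Real.exp (s * firstChaos B e ω) =
      Real.exp (firstChaos B (c + s • e) ω) := fun s ω => by
    rw [firstChaos_add, firstChaos_smul, Real.exp_add]
  have hS : sTransform B P (firstChaos B e) c =
      ∫ ω, firstChaos B e ω ∂(P.tilted (firstChaos B c)) := by
    rw [integral_tilted, integral_exp_firstChaos hB hc]
    refine integral_congr_ae (Eventually.of_forall fun ω => ?_)
    simp only [wickExp, Real.exp_sub, smul_eq_mul]
    ring
  have hset : integrableExpSet (firstChaos B e) (P.tilted (firstChaos B c)) = Set.univ := by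
    ext s
    simp only [integrableExpSet, Set.mem_ofPred_eq, Set.mem_univ, iff_true]
    rw [integrable_tilted_iff (integrable_exp_firstChaos hB hc c)]
    simp only [smul_eq_mul, hexp]
    exact integrable_exp_firstChaos hB hc _
  have hcov : ∀ s : ℝ, cov[firstChaos B c, firstChaos B (s • e); P] =
      s * cov[firstChaos B e, firstChaos B c; P] := fun s => by
    have : firstChaos B (s • e) = fun ω => s * firstChaos B e ω :=
      funext fun ω => firstChaos_smul s e ω
    rw [this, covariance_const_mul_right, covariance_comm]
  have hmgf : mgf (firstChaos B e) (P.tilted (firstChaos B c)) = fun s =>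
      Real.exp (s * cov[firstChaos B e, firstChaos B c; P] +
        s ^ 2 * (Var[firstChaos B e; P] / 2)) := by
    ext s
    rw [mgf, integral_tilted, integral_exp_firstChaos hB hc]
    simp only [smul_eq_mul, div_mul_eq_mul_div, hexp]
    rw [integral_div, integral_exp_firstChaos hB hc, variance_firstChaos_add hB,
      variance_firstChaos_smul, hcov, ← Real.exp_sub]
    congr 1
    ring
  rw [hS, ← deriv_mgf_zero (by rw [hset]; simp), hmgf]
  have hd : HasDerivAt (fun s : ℝ => s * cov[firstChaos B e, firstChaos B c; P] +
      s ^ 2 * (Var[firstChaos B e; P] / 2)) (1 * cov[firstChaos B e, firstChaos B c; P] +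
      ((2 : ℕ) * (0 : ℝ) ^ 1 * 1) * (Var[firstChaos B e; P] / 2)) 0 :=
    ((hasDerivAt_id' (0 : ℝ)).mul_const _).add (((hasDerivAt_id' (0 : ℝ)).pow 2).mul_const _)
  rw [hd.exp.deriv]
  simp

/-! ### Totality of the Wick exponentials -/

lemma sigmaAlgebra_eq_comap :
    sigmaAlgebra B = MeasurableSpace.comap (fun ω t => B t ω) MeasurableSpace.pi := by
  simp only [sigmaAlgebra, MeasurableSpace.pi, MeasurableSpace.comap_iSup,
    MeasurableSpace.comap_comp]
  rfl

lemma sigmaAlgebra_le (hm : ∀ t, Measurable (B t)) : sigmaAlgebra B ≤ mΩ :=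
  iSup_le fun t => (hm t).comap_le

lemma integrable_mul_exp_firstChaos (hB : IsGaussianProcess B P) (hc : ∀ t, ∫ ω, B t ω ∂P = 0)
    {D : Ω → ℝ} (hD : MemLp D 2 P) (c : ℝ≥0 →₀ ℝ) :
    Integrable (fun ω => D ω * Real.exp (firstChaos B c ω)) P := by
  refine ((hD.integrable_mul (memLp_wickExp hB hc c)).mul_const
    (Real.exp (Var[firstChaos B c; P] / 2))).congr (Eventually.of_forall fun ω => ?_)
  simp only [Pi.mul_apply, wickExp, mul_assoc, ← Real.exp_add]
  congr 2
  ring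

/-- If the `S`-transform of `D` vanishes, then the positive and the negative part of `D`, as
densities, give every element of the first chaos the same moment generating function, hence the
same law. -/
lemma map_withDensity_firstChaos_eq (hB : IsGaussianProcess B P) (hm : ∀ t, Measurable (B t))
    (hc : ∀ t, ∫ ω, B t ω ∂P = 0) {D : Ω → ℝ} (hDm : Measurable D) (hD : MemLp D 2 P)
    (h0 : ∀ c, sTransform B P D c = 0) (c : ℝ≥0 →₀ ℝ) :
    (P.withDensity fun ω => ENNReal.ofReal (D ω)).map (firstChaos B c) =
      (P.withDensity fun ω => ENNReal.ofReal (-D ω)).map (firstChaos B c) := by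
  have := hB.isProbabilityMeasure
  have hDi : Integrable D P := hD.integrable (by norm_num)
  have hf : ∀ E : Ω → ℝ, Integrable E P →
      IsFiniteMeasure (P.withDensity fun ω => ENNReal.ofReal (E ω)) :=
    fun E hE => isFiniteMeasure_withDensity_ofReal hE.2
  have := hf D hDi
  have := hf (fun ω => -D ω) hDi.neg
  have hξ : Measurable (firstChaos B c) := by
    have : firstChaos B c = fun ω => ∑ t ∈ c.support, c t * B t ω := rfl
    rw [this]
    exact Finset.measurable_fun_sum _ fun t _ => (hm t).const_mul _
  have hmgf_eq : ∀ E : Ω → ℝ, Measurable E → ∀ s,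
      mgf (firstChaos B c) (P.withDensity fun ω => ENNReal.ofReal (E ω)) s =
        ∫ ω, max (E ω) 0 * Real.exp (firstChaos B (s • c) ω) ∂P := by
    intro E hE s
    rw [mgf, integral_withDensity_eq_integral_toReal_smul (by fun_prop) (by simp)]
    simp only [ENNReal.toReal_ofReal', smul_eq_mul, firstChaos_smul]
  have hint : ∀ s : ℝ, Integrable (fun ω => max (D ω) 0 * Real.exp (firstChaos B (s • c) ω)) P :=
    fun s => integrable_mul_exp_firstChaos hB hc hD.pos_part _
  have hint' : ∀ s : ℝ, Integrable (fun ω => max (-D ω) 0 * Real.exp (firstChaos B (s • c) ω)) P :=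
    fun s => integrable_mul_exp_firstChaos hB hc hD.neg_part _
  have hmgf : mgf (firstChaos B c) (P.withDensity fun ω => ENNReal.ofReal (D ω)) =
      mgf (firstChaos B c) (P.withDensity fun ω => ENNReal.ofReal (-D ω)) := by
    ext s
    rw [hmgf_eq D hDm, hmgf_eq (fun ω => -D ω) hDm.neg, ← sub_eq_zero,
      ← integral_sub (hint s) (hint' s)]
    have e : ∀ ω, max (D ω) 0 * Real.exp (firstChaos B (s • c) ω) -
        max (-D ω) 0 * Real.exp (firstChaos B (s • c) ω) =
        D ω * wickExp B P (s • c) ω * Real.exp (Var[firstChaos B (s • c); P] / 2) := by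
      intro ω
      rw [← sub_mul, mul_assoc, wickExp, ← Real.exp_add]
      congr 1
      · exact max_zero_sub_max_neg_zero_eq_self (D ω)
      · congr 1
        ring
    simp only [e]
    rw [integral_mul_const]
    have := h0 (s • c)
    rw [sTransform] at this
    rw [this, zero_mul]
  have hset : integrableExpSet (firstChaos B c) (P.withDensity fun ω => ENNReal.ofReal (D ω)) =
      Set.univ := by
    ext s
    simp only [integrableExpSet, Set.mem_ofPred_eq, Set.mem_univ, iff_true]
    rw [integrable_withDensity_iff_integrable_smul' (by fun_prop) (by simp)]
    simp only [ENNReal.toReal_ofReal', smul_eq_mul, ← firstChaos_smul]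
    exact hint s
  refine Measure.ext_of_complexMGF_eq hξ.aemeasurable hξ.aemeasurable ?_
  ext z
  refine eqOn_complexMGF_of_mgf' hmgf ?_ (by rw [hset]; simp)
  -- the two measures have the same mass, so that one vanishes if and only if the other does
  have h := congrFun hmgf 0
  rw [mgf_zero', mgf_zero'] at h
  rw [← Measure.measure_univ_eq_zero, ← Measure.measure_univ_eq_zero, ← measureReal_eq_zero_iff,
    ← measureReal_eq_zero_iff, h]

lemma map_withDensity_process_eq (hB : IsGaussianProcess B P) (hm : ∀ t, Measurable (B t))
    (hc : ∀ t, ∫ ω, B t ω ∂P = 0) {D : Ω → ℝ} (hDm : Measurable D) (hD : MemLp D 2 P)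
    (h0 : ∀ c, sTransform B P D c = 0) :
    (P.withDensity fun ω => ENNReal.ofReal (D ω)).map (fun ω t => B t ω) =
      (P.withDensity fun ω => ENNReal.ofReal (-D ω)).map (fun ω t => B t ω) := by
  have := hB.isProbabilityMeasure
  have hDi : Integrable D P := hD.integrable (by norm_num)
  have : IsFiniteMeasure (P.withDensity fun ω => ENNReal.ofReal (D ω)) :=
    isFiniteMeasure_withDensity_ofReal hDi.2
  have : IsFiniteMeasure (P.withDensity fun ω => ENNReal.ofReal (-D ω)) :=
    isFiniteMeasure_withDensity_ofReal hDi.neg.2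
  have hBm : Measurable fun ω t => B t ω := measurable_pi_lambda _ hm
  set μ := (P.withDensity fun ω => ENNReal.ofReal (D ω)).map (fun ω t => B t ω)
  set ν := (P.withDensity fun ω => ENNReal.ofReal (-D ω)).map (fun ω t => B t ω)
  refine IsProjectiveLimit.unique (P := fun I => μ.map I.restrict) (fun _ => rfl) fun I => ?_
  refine Measure.ext_of_charFunDual ?_
  ext L
  rw [charFunDual_eq_charFun_map_one, charFunDual_eq_charFun_map_one]
  congr 1
  -- a continuous linear form on `ℝ^I` composed with the process is an element of the first chaos
  set c : ℝ≥0 →₀ ℝ := ∑ i : I, Finsupp.single (i : ℝ≥0) (L (Pi.single i 1)) with hcdef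
  have hL : ∀ ω, L (I.restrict fun t => B t ω) = firstChaos B c ω := by
    intro ω
    have hsum : ∀ s : Finset I, firstChaos B
        (∑ i ∈ s, Finsupp.single (i : ℝ≥0) (L (Pi.single i 1))) ω =
        ∑ i ∈ s, L (Pi.single i 1) * B i ω := by
      intro s
      induction s using Finset.induction with
      | empty => simp [firstChaos]
      | insert i s hi ih =>
        rw [Finset.sum_insert hi, Finset.sum_insert hi, firstChaos_add, ih, firstChaos_single]
    rw [hcdef, hsum]
    refine (LinearMap.pi_apply_eq_sum_univ L.toLinearMap _).trans
      (Finset.sum_congr rfl fun i _ => ?_)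
    rw [smul_eq_mul, mul_comm]
    congr 1
    refine congrArg L ?_
    ext j
    simp [Pi.single_apply, eq_comm]
  have hcomp : ∀ κ : Measure Ω, ((κ.map fun ω t => B t ω).map I.restrict).map L =
      κ.map (firstChaos B c) := by
    intro κ
    rw [Measure.map_map (Finset.measurable_restrict I) hBm,
      Measure.map_map L.measurable ((Finset.measurable_restrict I).comp hBm)]
    congr 1
    ext ω
    exact hL ω
  rw [hcomp, hcomp]
  exact (map_withDensity_firstChaos_eq hB hm hc hDm hD h0 c).symm

/-- A square-integrable functional of `B` is determined by its `S`-transform. -/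
lemma ae_eq_zero_of_sTransform_eq_zero (hB : IsGaussianProcess B P) (hm : ∀ t, Measurable (B t))
    (hc : ∀ t, ∫ ω, B t ω ∂P = 0) {D : Ω → ℝ} (hD : IsL2Functional B P D)
    (h0 : ∀ c, sTransform B P D c = 0) : D =ᵐ[P] 0 := by
  obtain ⟨D', hD'm, hDD'⟩ := hD.measurable_of
  have hle := sigmaAlgebra_le (mΩ := mΩ) hm
  -- on `{E > 0}`, an event of the `σ`-algebra of `B`, the densities `E⁺` and `E⁻` have equal mass,
  -- and that of `E⁻` is `0`
  have key : ∀ E : Ω → ℝ, StronglyMeasurable[sigmaAlgebra B] E → MemLp E 2 P →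
      (∀ c, sTransform B P E c = 0) → ∀ᵐ ω ∂P, E ω ≤ 0 := by
    intro E hEm hE hE0
    have hEm' : Measurable E := (hEm.mono hle).measurable
    have hset : MeasurableSet[sigmaAlgebra B] {ω | 0 < E ω} :=
      hEm.measurable measurableSet_Ioi
    have hset' : MeasurableSet {ω | 0 < E ω} := hle _ hset
    rw [sigmaAlgebra_eq_comap] at hset
    obtain ⟨C, hC, hCE⟩ := hset
    have h := congrArg (fun μ => μ C) (map_withDensity_process_eq hB hm hc hEm' hE hE0)
    have hBm : Measurable fun ω t => B t ω := measurable_pi_lambda _ hm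
    simp only [Measure.map_apply hBm hC, hCE, withDensity_apply _ hset'] at h
    have hz : ∫⁻ ω in {ω | 0 < E ω}, ENNReal.ofReal (-E ω) ∂P = 0 := by
      rw [setLIntegral_eq_zero_iff hset' (by fun_prop)]
      refine Eventually.of_forall fun ω hω => ?_
      rw [ENNReal.ofReal_eq_zero]
      have : 0 < E ω := hω
      linarith
    rw [hz, setLIntegral_eq_zero_iff hset' (by fun_prop)] at h
    filter_upwards [h] with ω hω
    by_contra! hpos
    exact absurd (ENNReal.ofReal_eq_zero.1 (hω hpos)) (not_le.2 hpos)
  have hD'2 : MemLp D' 2 P := hD.memLp.ae_eq hDD'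
  have hD'0 : ∀ c, sTransform B P D' c = 0 := fun c => by
    rw [← h0 c]
    refine integral_congr_ae ?_
    filter_upwards [hDD'] with ω hω
    rw [hω]
  have h1 := key D' hD'm hD'2 hD'0
  have h2 := key (-D') hD'm.neg hD'2.neg fun c => by
    have := hD'0 c
    simp only [sTransform, Pi.neg_apply, neg_mul, integral_neg] at this ⊢
    rw [this, neg_zero]
  filter_upwards [hDD', h1, h2] with ω hω h1 h2
  rw [hω]
  simp only [Pi.neg_apply, Left.neg_nonpos_iff] at h2
  exact le_antisymm h1 h2

end Gaussian

/-! ### Solving the stock price equation -/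

section StockPrice

variable {Ω : Type*} {mΩ : MeasurableSpace Ω} {P : Measure Ω} {B : ℝ≥0 → Ω → ℝ} {H : ℝ}

/-- The covariance of `B_r` and `∑ᵢ cᵢ B(tᵢ)` for a fractional Brownian motion `B`, as a function
of a time `r` in `ℝ`; the value at negative `r` is immaterial. -/
def chaosCov (H : ℝ) (c : ℝ≥0 →₀ ℝ) (r : ℝ) : ℝ :=
  ∑ t ∈ c.support, c t * ((|r| ^ (2 * H) + (t : ℝ) ^ (2 * H) - |(t : ℝ) - r| ^ (2 * H)) / 2)

lemma continuous_chaosCov (hH : 0 < H) (c : ℝ≥0 →₀ ℝ) : Continuous (chaosCov H c) := by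
  have hp : 0 ≤ 2 * H := by positivity
  refine continuous_finsetSum _ fun t _ => continuous_const.mul (Continuous.div_const ?_ _)
  exact ((continuous_abs.rpow_const fun _ => Or.inr hp).add continuous_const).sub
    ((continuous_const.sub continuous_id).abs.rpow_const fun _ => Or.inr hp)

lemma contDiffAt_chaosCov (c : ℝ≥0 →₀ ℝ) {r : ℝ} (hr : r ≠ 0)
    (hc : r ∉ (fun t : ℝ≥0 => (t : ℝ)) '' c.support) : ContDiffAt ℝ 1 (chaosCov H c) r := by
  have habs : ∀ {x : ℝ}, x ≠ 0 → ContDiffAt ℝ 1 (fun y : ℝ => |y|) x :=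
    fun hx => contDiffAt_abs (n := 1) hx
  refine ContDiffAt.sum fun t ht => contDiffAt_const.mul (ContDiffAt.div_const ?_ _)
  have htr : (t : ℝ) - r ≠ 0 := fun h => hc ⟨t, ht, by simpa using sub_eq_zero.1 h⟩
  have h2 : ContDiffAt ℝ 1 (fun y : ℝ => |(t : ℝ) - y|) r :=
    (habs htr).comp (f := fun y : ℝ => (t : ℝ) - y) r (contDiffAt_const.sub contDiffAt_id)
  exact (((habs hr).rpow_const_of_ne (abs_ne_zero.2 hr)).add contDiffAt_const).sub
    (h2.rpow_const_of_ne (abs_ne_zero.2 htr))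

lemma chaosCov_zero (hH : 0 < H) (c : ℝ≥0 →₀ ℝ) : chaosCov H c 0 = 0 := by
  refine Finset.sum_eq_zero fun t _ => ?_
  simp [Real.zero_rpow (by positivity : 2 * H ≠ 0)]

lemma IsFractionalBrownianMotion.covariance_firstChaos (hB : IsFractionalBrownianMotion H B P)
    (r : ℝ≥0) (c : ℝ≥0 →₀ ℝ) : cov[B r, firstChaos B c; P] = chaosCov H c r := by
  have := hB.isGaussianProcess.isProbabilityMeasure
  have hmem : ∀ t, MemLp (B t) 2 P := fun t =>
    (hB.isGaussianProcess.hasGaussianLaw_eval t).memLp_two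
  have e : firstChaos B c = fun ω => ∑ t ∈ c.support, c t * B t ω := rfl
  rw [e, covariance_fun_sum_right' (fun t _ => (hmem t).const_mul _) (hmem r)]
  refine Finset.sum_congr rfl fun t _ => ?_
  rw [covariance_const_mul_right, hB.covariance_eq, abs_of_nonneg r.coe_nonneg]

lemma IsFractionalBrownianMotion.variance_eq (hB : IsFractionalBrownianMotion H B P) (hH : 0 < H)
    (t : ℝ≥0) : Var[B t; P] = (t : ℝ) ^ (2 * H) := by
  rw [← covariance_self (hB.measurable t).aemeasurable, hB.covariance_eq]
  simp [Real.zero_rpow (by positivity : 2 * H ≠ 0)]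

/-- The `S`-transform turns the Wick-Itô-Skorohod equation into a linear integral equation along
`cov(B_t, ξ)`, which is solved by an exponential. -/
lemma IsStockPrice.sTransform_eq (hB : IsFractionalBrownianMotion H B P) (hH : 0 < H) {T : ℝ≥0}
    {σ s₀ : ℝ} {S : ℝ≥0 → Ω → ℝ} (hS : IsStockPrice B P T σ s₀ S) {t : ℝ≥0} (ht : t ≤ T)
    (c : ℝ≥0 →₀ ℝ) : sTransform B P (S t) c = s₀ * Real.exp (σ * chaosCov H c t) := by
  have hG := hB.isGaussianProcess
  have := hG.isProbabilityMeasure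
  set F : ℝ → ℝ := fun u => sTransform B P (S u.toNNReal) c with hF
  have hW : Integrable (wickExp B P c) P :=
    (memLp_wickExp hG hB.centered c).integrable (by norm_num)
  have hSW : ∀ r ≤ T, Integrable (fun ω => (S r ω - s₀) * wickExp B P c ω) P := fun r hr =>
    (hS.equation r hr).integral.memLp.integrable_mul (memLp_wickExp hG hB.centered c)
  have hlin : ∀ r ≤ T, sTransform B P (fun ω => S r ω - s₀) c = sTransform B P (S r) c - s₀ := by
    intro r hr
    have e : ∀ ω, S r ω * wickExp B P c ω = (S r ω - s₀) * wickExp B P c ω +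
        s₀ * wickExp B P c ω := fun ω => by ring
    have h : sTransform B P (S r) c = sTransform B P (fun ω => S r ω - s₀) c + s₀ := by
      simp only [sTransform, e]
      rw [integral_add (hSW r hr) (hW.const_mul _), integral_const_mul,
        integral_wickExp hG hB.centered, mul_one]
    rw [h, add_sub_cancel_right]
  have hderiv : ∀ u : ℝ, 0 < u →
      deriv (fun r : ℝ => sTransform B P (B r.toNNReal) c) u = deriv (chaosCov H c) u := by
    intro u hu
    refine Filter.EventuallyEq.deriv_eq ?_
    filter_upwards [Ioi_mem_nhds hu] with r hr
    rw [sTransform_eval hG hB.centered, hB.covariance_firstChaos,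
      Real.coe_toNNReal _ (le_of_lt hr)]
  have hintegrand : ∀ r : ℝ≥0, Set.EqOn (fun u : ℝ => sTransform B P
      (fun ω => σ * S u.toNNReal ω) c * deriv (fun r : ℝ => sTransform B P (B r.toNNReal) c) u)
      (fun u => F u * deriv (fun x => σ * chaosCov H c x) u) (Set.uIoc 0 (r : ℝ)) := by
    intro r u hu
    rw [Set.uIoc_of_le r.coe_nonneg] at hu
    simp only
    rw [hderiv u hu.1, deriv_const_mul_field]
    simp only [hF, sTransform, mul_assoc]
    rw [integral_const_mul]
    ring
  have hode := eq_mul_exp_of_integral_equation (F := F) (G := fun x => σ * chaosCov H c x)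
    (a := s₀) (T := t) (s := (fun t : ℝ≥0 => (t : ℝ)) '' c.support)
    (c.support.countable_toSet.image _) t.coe_nonneg
    ((continuous_const.mul (continuous_chaosCov hH c)).continuousOn)
    (fun x hx => contDiffAt_const.mul (contDiffAt_chaosCov c hx.1.1.ne' hx.2))
    (((hS.equation t ht).intervalIntegrable c).congr (hintegrand t))
    (fun r hr => by
      lift r to ℝ≥0 using hr.1
      have hrt : r ≤ T := le_trans (by exact_mod_cast hr.2) ht
      have h := (hS.equation r hrt).sTransform_eq c
      rw [hlin r hrt, intervalIntegral.integral_congr_ae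
        (Eventually.of_forall fun u hu => hintegrand r hu)] at h
      simp only [hF, Real.toNNReal_coe]
      linarith)
  simpa [hF, chaosCov_zero hH] using hode

lemma stronglyMeasurable_wickExp (c : ℝ≥0 →₀ ℝ) :
    StronglyMeasurable[sigmaAlgebra B] (wickExp B P c) := by
  have hB : ∀ t, Measurable[sigmaAlgebra B] (B t) := fun t =>
    measurable_iff_comap_le.2 (le_iSup (fun t => MeasurableSpace.comap (B t) inferInstance) t)
  have h1 : Measurable[sigmaAlgebra B] (firstChaos B c) := by
    have : firstChaos B c = fun ω => ∑ t ∈ c.support, c t * B t ω := rfl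
    rw [this]
    exact Finset.measurable_fun_sum _ fun t _ => (hB t).const_mul _
  exact (Real.measurable_exp.comp (h1.sub_const _)).stronglyMeasurable

/-- The stock price is the Wick exponential `s₀ exp (σ B_t - σ² t ^ (2H) / 2)`. -/
lemma IsStockPrice.ae_eq (hB : IsFractionalBrownianMotion H B P) (hH : 0 < H) {T : ℝ≥0}
    {σ s₀ : ℝ} {S : ℝ≥0 → Ω → ℝ} (hS : IsStockPrice B P T σ s₀ S) {t : ℝ≥0} (ht : t ≤ T) :
    S t =ᵐ[P] fun ω => s₀ * wickExp B P (Finsupp.single t σ) ω := by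
  have hG := hB.isGaussianProcess
  have := hG.isProbabilityMeasure
  set W := wickExp B P (Finsupp.single t σ)
  have hI := (hS.equation t ht).integral
  have hWm := memLp_wickExp hG hB.centered (Finsupp.single t σ)
  have hD : IsL2Functional B P fun ω => (S t ω - s₀) + (s₀ - s₀ * W ω) :=
    ⟨hI.measurable_of.add (stronglyMeasurable_const.sub
      (stronglyMeasurable_const.mul (stronglyMeasurable_wickExp _))).aestronglyMeasurable,
      hI.memLp.add ((memLp_const s₀).sub (hWm.const_mul s₀))⟩
  have h0 := ae_eq_zero_of_sTransform_eq_zero hG hB.measurable hB.centered hD fun c => by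
    have hWc := memLp_wickExp hG hB.centered c
    have hSi : Integrable (fun ω => S t ω * wickExp B P c ω) P := by
      have h : MemLp (fun ω => (S t ω - s₀) + s₀) 2 P := hI.memLp.add (memLp_const s₀)
      simp only [sub_add_cancel] at h
      exact h.integrable_mul hWc
    have e : ∀ ω, ((S t ω - s₀) + (s₀ - s₀ * W ω)) * wickExp B P c ω =
        S t ω * wickExp B P c ω - s₀ * (W ω * wickExp B P c ω) := fun ω => by ring
    have hcov : cov[firstChaos B (Finsupp.single t σ), firstChaos B c; P] =
        σ * chaosCov H c t := by
      have : firstChaos B (Finsupp.single t σ) = fun ω => σ * B t ω :=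
        funext fun ω => firstChaos_single t σ ω
      rw [this, covariance_const_mul_left, hB.covariance_firstChaos]
    have h1 := hS.sTransform_eq hB hH ht c
    have h2 := sTransform_wickExp hG hB.centered c (Finsupp.single t σ)
    rw [hcov] at h2
    simp only [sTransform] at h1 h2 ⊢
    simp only [e]
    have hWi : Integrable (fun ω => W ω * wickExp B P c ω) P := hWm.integrable_mul hWc
    rw [integral_sub hSi (hWi.const_mul s₀), integral_const_mul, h1, h2, sub_self]
  filter_upwards [h0] with ω hω
  simp only [Pi.zero_apply] at hω
  linarith

lemma IsStockPrice.log_ae_eq (hB : IsFractionalBrownianMotion H B P) (hH : 0 < H) {T : ℝ≥0}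
    {σ s₀ : ℝ} (hs₀ : 0 < s₀) {S : ℝ≥0 → Ω → ℝ} (hS : IsStockPrice B P T σ s₀ S) {t : ℝ≥0}
    (ht : t ≤ T) : ∀ᵐ ω ∂P,
      Real.log (S t ω) = Real.log s₀ + (σ * B t ω - σ ^ 2 * (t : ℝ) ^ (2 * H) / 2) := by
  have hvar : Var[firstChaos B (Finsupp.single t σ); P] = σ ^ 2 * (t : ℝ) ^ (2 * H) := by
    have : firstChaos B (Finsupp.single t σ) = fun ω => σ * B t ω :=
      funext fun ω => firstChaos_single t σ ω
    rw [this, variance_const_mul, hB.variance_eq hH]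
  filter_upwards [hS.ae_eq hB hH ht] with ω hω
  rw [hω, wickExp, Real.log_mul hs₀.ne' (Real.exp_pos _).ne', Real.log_exp, firstChaos_single,
    hvar]

end StockPrice

/-! ### Increments of fractional Brownian motion -/

section Increments

variable {Ω : Type*} {mΩ : MeasurableSpace Ω} {P : Measure Ω} {B : ℝ≥0 → Ω → ℝ} {H : ℝ}

/-- The increment of `B` over `[i h, (i + 1) h]`, divided by `h ^ H`. -/
def normIncrement (H : ℝ) (B : ℝ≥0 → Ω → ℝ) (h : ℝ≥0) (i : ℕ) (ω : Ω) : ℝ :=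
  ((h : ℝ) ^ H)⁻¹ * (B (((i : ℝ≥0) + 1) * h) ω - B ((i : ℝ≥0) * h) ω)

lemma IsFractionalBrownianMotion.hasGaussianLaw_normIncrement
    (hB : IsFractionalBrownianMotion H B P) (h : ℝ≥0) (N : ℕ) :
    HasGaussianLaw (fun ω (i : Fin N) => normIncrement H B h i ω) P := by
  have h1 := (hB.isGaussianProcess.hasGaussianLaw_increments (n := N)
    (t := fun i => ((i : ℕ) : ℝ≥0) * h)).fun_smul ((h : ℝ) ^ H)⁻¹
  convert! h1 using 3 with ω i
  simp [normIncrement]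

lemma IsFractionalBrownianMotion.memLp_normIncrement (hB : IsFractionalBrownianMotion H B P)
    (h : ℝ≥0) (i : ℕ) : MemLp (normIncrement H B h i) 2 P :=
  ((hB.hasGaussianLaw_normIncrement h (i + 1)).eval ⟨i, by omega⟩).memLp_two

lemma IsFractionalBrownianMotion.integral_normIncrement (hB : IsFractionalBrownianMotion H B P)
    (h : ℝ≥0) (i : ℕ) : ∫ ω, normIncrement H B h i ω ∂P = 0 := by
  have hi := fun t => (hB.isGaussianProcess.hasGaussianLaw_eval t).integrable
  simp only [normIncrement]
  rw [integral_const_mul, integral_sub (hi _) (hi _), hB.centered, hB.centered]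
  simp

lemma IsFractionalBrownianMotion.covariance_normIncrement (hB : IsFractionalBrownianMotion H B P)
    {h : ℝ≥0} (hh : 0 < h) (i j : ℕ) :
    cov[normIncrement H B h i, normIncrement H B h j; P] = incrementCorr H ((i : ℤ) - j) := by
  have := hB.isGaussianProcess.isProbabilityMeasure
  have hm := fun t => (hB.isGaussianProcess.hasGaussianLaw_eval t).memLp_two
  have e : ∀ i, normIncrement H B h i = fun ω => ((h : ℝ) ^ H)⁻¹ *
    (B (((i : ℝ≥0) + 1) * h) ω - B ((i : ℝ≥0) * h) ω) := fun _ => rfl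
  have hh' : (0 : ℝ) < h := hh
  rw [e, e, covariance_const_mul_left, covariance_const_mul_right,
    covariance_fun_sub_fun_sub (hm _) (hm _) (hm _) (hm _)]
  simp only [hB.covariance_eq]
  have habs : ∀ x : ℝ, |x * h| ^ (2 * H) = |x| ^ (2 * H) * (h : ℝ) ^ (2 * H) := fun x => by
    rw [abs_mul, abs_of_pos hh', Real.mul_rpow (abs_nonneg _) hh'.le]
  push_cast
  have e1 : (((j : ℝ) + 1) * h - ((i : ℝ) + 1) * h) = (-((i : ℝ) - j)) * h := by ring
  have e2 : ((j : ℝ) * h - ((i : ℝ) + 1) * h) = (-((i : ℝ) - j + 1)) * h := by ring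
  have e3 : (((j : ℝ) + 1) * h - (i : ℝ) * h) = (-((i : ℝ) - j - 1)) * h := by ring
  have e4 : ((j : ℝ) * h - (i : ℝ) * h) = (-((i : ℝ) - j)) * h := by ring
  rw [e1, e2, e3, e4, habs, habs, habs, abs_neg, abs_neg, abs_neg, incrementCorr]
  push_cast
  have hp : (h : ℝ) ^ (2 * H) = ((h : ℝ) ^ H) ^ 2 := by
    rw [← Real.rpow_natCast, ← Real.rpow_mul hh'.le]
    congr 1
    push_cast
    ring
  have hne : (h : ℝ) ^ H ≠ 0 := (Real.rpow_pos_of_pos hh' H).ne'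
  rw [hp]
  field_simp
  ring

end Increments

/-! ### Negligible terms -/

section Remainder

variable {Ω : Type*} {mΩ : MeasurableSpace Ω} {P : Measure Ω}

/-- The quadratic form of a symmetric matrix is bounded by its largest absolute row sum. -/
lemma sum_mul_mul_le {ι : Type*} [Fintype ι] (R : ι → ι → ℝ) (hR : ∀ i j, R i j = R j i) {M : ℝ}
    (hM : ∀ i, ∑ j, |R i j| ≤ M) (a : ι → ℝ) :
    ∑ i, ∑ j, a i * a j * R i j ≤ M * ∑ i, a i ^ 2 := by
  have h1 : ∀ i j, a i * a j * R i j ≤ a i ^ 2 / 2 * |R i j| + a j ^ 2 / 2 * |R j i| := by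
    intro i j
    rw [hR j i, ← add_mul]
    calc a i * a j * R i j ≤ |a i * a j| * |R i j| := by
          rw [← abs_mul]; exact le_abs_self _
      _ ≤ _ := by
          gcongr
          rw [abs_mul]
          nlinarith [sq_nonneg (|a i| - |a j|), sq_abs (a i), sq_abs (a j)]
  have h2 : ∑ i, ∑ j, a i ^ 2 / 2 * |R i j| ≤ M / 2 * ∑ i, a i ^ 2 := by
    rw [Finset.mul_sum]
    refine Finset.sum_le_sum fun i _ => ?_
    rw [← Finset.mul_sum]
    nlinarith [hM i, sq_nonneg (a i)]
  calc ∑ i, ∑ j, a i * a j * R i j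
      ≤ ∑ i, ∑ j, (a i ^ 2 / 2 * |R i j| + a j ^ 2 / 2 * |R j i|) :=
        Finset.sum_le_sum fun i _ => Finset.sum_le_sum fun j _ => h1 i j
    _ = ∑ i, ∑ j, a i ^ 2 / 2 * |R i j| + ∑ i, ∑ j, a i ^ 2 / 2 * |R i j| := by
        simp only [Finset.sum_add_distrib]
        congr 1
        exact Finset.sum_comm
    _ ≤ M * ∑ i, a i ^ 2 := by linarith

lemma tendstoInMeasure_zero_of_variance [IsProbabilityMeasure P] {Y : ℕ → Ω → ℝ}
    (hY : ∀ N, MemLp (Y N) 2 P) (hv : Tendsto (fun N => Var[Y N; P]) atTop (𝓝 0))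
    (hm : Tendsto (fun N => ∫ ω, Y N ω ∂P) atTop (𝓝 0)) :
    TendstoInMeasure P Y atTop fun _ => 0 := by
  rw [tendstoInMeasure_iff_measureReal_norm]
  intro ε hε
  have hlim : Tendsto (fun N => (ε ^ 2)⁻¹ * (Var[Y N; P] + (∫ ω, Y N ω ∂P) ^ 2)) atTop (𝓝 0) := by
    simpa using (hv.add (hm.pow 2)).const_mul (ε ^ 2)⁻¹
  refine squeeze_zero (fun _ => measureReal_nonneg) (fun N => ?_) hlim
  have h1 := mul_meas_ge_le_integral_of_nonneg (μ := P) (f := fun ω => Y N ω ^ 2)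
    (Eventually.of_forall fun ω => sq_nonneg _) (hY N).integrable_sq (ε ^ 2)
  have h2 : {x | ε ≤ ‖Y N x - 0‖} = {x | ε ^ 2 ≤ Y N x ^ 2} := by
    ext x
    simp only [Set.mem_ofPred_eq, sub_zero, Real.norm_eq_abs]
    rw [sq_le_sq, abs_of_pos hε]
  have h3 := variance_eq_sub (hY N)
  simp only [Pi.pow_apply] at h3
  rw [h2, le_inv_mul_iff₀ (by positivity), h3, sub_add_cancel]
  exact h1

end Remainder

/-! ### The estimator -/

section Estimator

variable {Ω : Type*} {mΩ : MeasurableSpace Ω} {P : Measure Ω} {B S : ℝ≥0 → Ω → ℝ} {H : ℝ}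

/-- The increment of `x ↦ x ^ (2H)` over `[i, i + 1]`. -/
def driftIncrement (H : ℝ) (i : ℕ) : ℝ := ((i : ℝ) + 1) ^ (2 * H) - (i : ℝ) ^ (2 * H)

/-- The contribution of the drift `- σ² t ^ (2H) / 2` of the logarithm to the normalised error of
the estimator, for `N` observations with step `h`. -/
def driftError (H : ℝ) (B : ℝ≥0 → Ω → ℝ) (σ : ℝ) (h : ℝ≥0) (N : ℕ) (ω : Ω) : ℝ :=
  ∑ i : Fin N, (-(√(N : ℝ))⁻¹ * σ ^ 3 * (h : ℝ) ^ H * driftIncrement H i) *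
      normIncrement H B h i ω +
    (√(N : ℝ))⁻¹ * (σ ^ 4 / 4) * (h : ℝ) ^ (2 * H) * ∑ i ∈ Finset.range N, driftIncrement H i ^ 2

lemma IsStockPrice.volEstimator_ae_eq (hB : IsFractionalBrownianMotion H B P) (hH : 0 < H)
    {T : ℝ≥0} (hT : 0 < T) {σ s₀ : ℝ} (hs₀ : 0 < s₀) (hS : IsStockPrice B P T σ s₀ S) (N : ℕ) :
    ∀ᵐ ω ∂P, √(N : ℝ) * (volEstimator H T S N ω - σ ^ 2) =
      σ ^ 2 * ((√(N : ℝ))⁻¹ * ∑ i : Fin N, (normIncrement H B (T / N) i ω ^ 2 - 1)) +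
        driftError H B σ (T / N) N ω := by
  rcases Nat.eq_zero_or_pos N with rfl | hN
  · simp [driftError]
  have hN0 : (0 : ℝ≥0) < N := by exact_mod_cast hN
  have hNR : (0 : ℝ) < N := by exact_mod_cast hN
  set h : ℝ≥0 := T / N with hh
  have hpos : (0 : ℝ) < h := by
    have : 0 < h := by positivity
    exact this
  have hle : ∀ k : ℕ, k ≤ N → (k : ℝ≥0) * h ≤ T := by
    intro k hk
    rw [hh, mul_div_assoc', div_le_iff₀ hN0, mul_comm]
    gcongr
  have hlog : ∀ᵐ ω ∂P, ∀ k : ℕ, k ≤ N → Real.log (S ((k : ℝ≥0) * h) ω) = Real.log s₀ +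
      (σ * B ((k : ℝ≥0) * h) ω - σ ^ 2 * (((k : ℝ≥0) * h : ℝ≥0) : ℝ) ^ (2 * H) / 2) := by
    rw [ae_all_iff]
    intro k
    by_cases hk : k ≤ N
    · filter_upwards [hS.log_ae_eq hB hH hs₀ (hle k hk)] with ω hω _
      exact hω
    · exact Eventually.of_forall fun ω h => absurd h hk
  filter_upwards [hlog] with ω hω
  have hhH : (h : ℝ) ^ H ≠ 0 := (Real.rpow_pos_of_pos hpos H).ne'
  have hp : (h : ℝ) ^ (2 * H) = ((h : ℝ) ^ H) ^ 2 := by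
    rw [← Real.rpow_natCast, ← Real.rpow_mul hpos.le]
    congr 1
    push_cast
    ring
  have hterm : ∀ k ∈ Finset.range N,
      (Real.log (S (((k : ℝ≥0) + 1) * h) ω) - Real.log (S ((k : ℝ≥0) * h) ω)) ^ 2 =
      ((h : ℝ) ^ H) ^ 2 * (σ ^ 2 * normIncrement H B h k ω ^ 2 -
        σ ^ 3 * (h : ℝ) ^ H * driftIncrement H k * normIncrement H B h k ω +
        σ ^ 4 / 4 * (h : ℝ) ^ (2 * H) * driftIncrement H k ^ 2) := by
    intro k hk
    have hk' : k < N := Finset.mem_range.1 hk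
    have h1 := hω (k + 1) hk'
    have h2 := hω k hk'.le
    push_cast at h1 h2
    rw [h1, h2, Real.mul_rpow (by positivity) hpos.le, Real.mul_rpow (by positivity) hpos.le, hp,
      normIncrement, driftIncrement]
    field_simp
    ring
  have hTN : (T : ℝ) / N = (h : ℝ) := by rw [hh]; push_cast; rfl
  have hsq : √(N : ℝ) ≠ 0 := (Real.sqrt_pos.2 hNR).ne'
  have hsqN : (N : ℝ) = √(N : ℝ) * √(N : ℝ) := (Real.mul_self_sqrt hNR.le).symm
  rw [volEstimator, hTN, ← hh, Finset.sum_congr rfl hterm, ← Finset.mul_sum,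
    Finset.sum_add_distrib, Finset.sum_sub_distrib, driftError,
    Fin.sum_univ_eq_sum_range (fun i => normIncrement H B h i ω ^ 2 - 1) N,
    Fin.sum_univ_eq_sum_range (fun i => (-(√(N : ℝ))⁻¹ * σ ^ 3 * (h : ℝ) ^ H *
      driftIncrement H i) * normIncrement H B h i ω) N, Finset.sum_sub_distrib]
  have e1 : ∑ i ∈ Finset.range N, (-(√(N : ℝ))⁻¹ * σ ^ 3 * (h : ℝ) ^ H * driftIncrement H i) *
      normIncrement H B h i ω = -(√(N : ℝ))⁻¹ * ∑ i ∈ Finset.range N,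
        σ ^ 3 * (h : ℝ) ^ H * driftIncrement H i * normIncrement H B h i ω := by
    rw [Finset.mul_sum]
    exact Finset.sum_congr rfl fun i _ => by ring
  rw [e1, ← Finset.mul_sum (Finset.range N) (fun i => normIncrement H B h i ω ^ 2) (σ ^ 2),
    ← Finset.mul_sum (Finset.range N) (fun i => driftIncrement H i ^ 2), hp]
  simp only [Finset.sum_const, Finset.card_range, nsmul_eq_mul, mul_one]
  generalize ∑ i ∈ Finset.range N, normIncrement H B h i ω ^ 2 = A
  generalize ∑ i ∈ Finset.range N,
    σ ^ 3 * (h : ℝ) ^ H * driftIncrement H i * normIncrement H B h i ω = C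
  generalize ∑ i ∈ Finset.range N, driftIncrement H i ^ 2 = D
  rw [hsqN]
  set q := √(N : ℝ)
  have hq : √(q * q) = q := Real.sqrt_mul_self (Real.sqrt_nonneg _)
  rw [hq]
  field_simp
  ring

/-- The cross term has variance at most the absolute row sum of the correlations, which is
`o(√N)`, times `h ^ (2H) ∑ dᵢ² / N`, with `dᵢ` the increments of `x ↦ x ^ (2H)`; the deterministic
term is of the order of `h ^ (2H) ∑ dᵢ² / √N`, which tends to `0` since `H < 3/4`. -/
lemma tendstoInMeasure_driftError [IsProbabilityMeasure P]
    (hB : IsFractionalBrownianMotion H B P) (hH₀ : 0 < H) (hH₁ : H < 3 / 4)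
    {T : ℝ≥0} (hT : 0 < T) (σ : ℝ) :
    (∀ N : ℕ, MemLp (driftError H B σ (T / N) N) 2 P) ∧
      TendstoInMeasure P (fun N : ℕ => driftError H B σ (T / N) N) atTop fun _ => 0 := by
  set q : ℕ → ℝ := fun N => (∑ i ∈ Finset.range N, driftIncrement H i ^ 2) /
    (N : ℝ) ^ (2 * H + 1 / 2) with hq
  have hq0 : Tendsto q atTop (𝓝 0) :=
    tendsto_sum_sq_rpow_increment (p := 2 * H) (by positivity) (by linarith)
  have hX := fun (N i : ℕ) => hB.memLp_normIncrement (T / N) i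
  have hsum : ∀ N : ℕ, MemLp (fun ω => ∑ i : Fin N, (-(√(N : ℝ))⁻¹ * σ ^ 3 *
      ((T / N : ℝ≥0) : ℝ) ^ H * driftIncrement H i) * normIncrement H B (T / N) i ω) 2 P :=
    fun N => memLp_finsetSum _ fun i _ => (hX N i).const_mul _
  have hmem : ∀ N : ℕ, MemLp (driftError H B σ (T / N) N) 2 P := fun N =>
    (hsum N).add (memLp_const _)
  -- the scaling `h ^ (2H) = T ^ (2H) N ^ (-2H)` turns `∑ dᵢ²` into `q N`
  have hscale : ∀ N : ℕ, 0 < N → ((T / N : ℝ≥0) : ℝ) ^ (2 * H) *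
      ∑ i ∈ Finset.range N, driftIncrement H i ^ 2 = (T : ℝ) ^ (2 * H) * √(N : ℝ) * q N := by
    intro N hN
    have hNR : (0 : ℝ) < N := by exact_mod_cast hN
    have h1 : (N : ℝ) ^ (2 * H + 1 / 2) = (N : ℝ) ^ (2 * H) * √(N : ℝ) := by
      rw [Real.rpow_add hNR, Real.sqrt_eq_rpow]
    have h2 : √(N : ℝ) ≠ 0 := (Real.sqrt_pos.2 hNR).ne'
    have h3 : (N : ℝ) ^ (2 * H) ≠ 0 := (Real.rpow_pos_of_pos hNR _).ne'
    simp only [hq]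
    rw [h1]
    push_cast
    rw [Real.div_rpow T.coe_nonneg hNR.le]
    field_simp
  refine ⟨hmem, tendstoInMeasure_zero_of_variance hmem ?_ ?_⟩
  · obtain ⟨K, hK⟩ := exists_toeplitz_row_le (incrementCorr H)
      (summable_incrementCorr_sq hH₀ hH₁) one_pos
    have hlim : Tendsto (fun N : ℕ => (K / √(N : ℝ) + 1) * (σ ^ 6 * (T : ℝ) ^ (2 * H)) * q N) atTop
        (𝓝 0) := by
      have h0 : Tendsto (fun N : ℕ => K / √(N : ℝ)) atTop (𝓝 0) :=
        Tendsto.const_div_atTop (Real.tendsto_sqrt_atTop.comp tendsto_natCast_atTop_atTop) _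
      simpa using ((h0.add_const 1).mul_const (σ ^ 6 * (T : ℝ) ^ (2 * H))).mul hq0
    refine squeeze_zero' (Eventually.of_forall fun _ => variance_nonneg _ _) ?_ hlim
    filter_upwards [eventually_gt_atTop 0] with N hN
    have hNR : (0 : ℝ) < N := by exact_mod_cast hN
    have hh : 0 < T / (N : ℝ≥0) := div_pos hT (by exact_mod_cast hN)
    set a : Fin N → ℝ := fun i => -(√(N : ℝ))⁻¹ * σ ^ 3 * ((T / N : ℝ≥0) : ℝ) ^ H *
      driftIncrement H i with ha
    have hvar : Var[driftError H B σ (T / N) N; P] =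
        ∑ i : Fin N, ∑ j : Fin N, a i * a j * incrementCorr H ((i : ℤ) - j) := by
      have e : driftError H B σ (T / N) N = fun ω => (∑ i : Fin N, a i *
          normIncrement H B (T / N) i ω) + (√(N : ℝ))⁻¹ * (σ ^ 4 / 4) *
          ((T / N : ℝ≥0) : ℝ) ^ (2 * H) * ∑ i ∈ Finset.range N, driftIncrement H i ^ 2 := rfl
      rw [e, variance_add_const (hsum N).1, ← covariance_self (hsum N).1.aemeasurable,
        covariance_fun_sum_fun_sum (fun i : Fin N => (hX N i).const_mul _)
          fun i : Fin N => (hX N i).const_mul _]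
      simp only [covariance_const_mul_left, covariance_const_mul_right,
        hB.covariance_normIncrement hh]
      exact Finset.sum_congr rfl fun i _ => Finset.sum_congr rfl fun j _ => by ring
    have hasq : ∑ i, a i ^ 2 = (N : ℝ)⁻¹ * σ ^ 6 * ((T / N : ℝ≥0) : ℝ) ^ (2 * H) *
        ∑ i ∈ Finset.range N, driftIncrement H i ^ 2 := by
      rw [← Fin.sum_univ_eq_sum_range (fun i => driftIncrement H i ^ 2), Finset.mul_sum]
      refine Finset.sum_congr rfl fun i _ => ?_
      have hp : ((T / N : ℝ≥0) : ℝ) ^ (2 * H) = (((T / N : ℝ≥0) : ℝ) ^ H) ^ 2 := by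
        rw [← Real.rpow_natCast, ← Real.rpow_mul (NNReal.coe_nonneg _)]
        congr 1
        push_cast
        ring
      have hs : (√(N : ℝ))⁻¹ ^ 2 = (N : ℝ)⁻¹ := by rw [inv_pow, Real.sq_sqrt hNR.le]
      rw [hp, ← hs]
      simp only [ha]
      ring
    rw [hvar]
    refine (sum_mul_mul_le (fun i j : Fin N => incrementCorr H ((i : ℤ) - j))
      (fun i j => by rw [← incrementCorr_neg, neg_sub]) (M := K + 1 * √(N : ℝ))
      (fun i => hK N i) a).trans (le_of_eq ?_)
    rw [hasq, mul_assoc _ (((T / N : ℝ≥0) : ℝ) ^ (2 * H)), hscale N hN]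
    have hs : (N : ℝ) = √(N : ℝ) * √(N : ℝ) := (Real.mul_self_sqrt hNR.le).symm
    have h2 : √(N : ℝ) ≠ 0 := (Real.sqrt_pos.2 hNR).ne'
    have hs' : (N : ℝ)⁻¹ = (√(N : ℝ))⁻¹ * (√(N : ℝ))⁻¹ := by
      rw [← mul_inv, ← hs]
    rw [hs']
    field_simp
  · have hmean : ∀ N : ℕ, ∫ ω, driftError H B σ (T / N) N ω ∂P = (√(N : ℝ))⁻¹ * (σ ^ 4 / 4) *
        ((T / N : ℝ≥0) : ℝ) ^ (2 * H) * ∑ i ∈ Finset.range N, driftIncrement H i ^ 2 := by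
      intro N
      simp only [driftError]
      rw [integral_add ((hsum N).integrable (by norm_num)) (integrable_const _),
        integral_finsetSum _ fun (i : Fin N) _ =>
          ((hX N i).integrable (by norm_num)).const_mul _]
      simp_rw [integral_const_mul, hB.integral_normIncrement]
      simp
    have hlim : Tendsto (fun N : ℕ => σ ^ 4 / 4 * (T : ℝ) ^ (2 * H) * q N) atTop (𝓝 0) := by
      simpa using hq0.const_mul (σ ^ 4 / 4 * (T : ℝ) ^ (2 * H))
    refine hlim.congr' ?_
    filter_upwards [eventually_gt_atTop 0] with N hN
    have h2 : √(N : ℝ) ≠ 0 := (Real.sqrt_pos.2 (by exact_mod_cast hN)).ne'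
    rw [hmean, mul_assoc _ (((T / N : ℝ≥0) : ℝ) ^ (2 * H)), hscale N hN]
    field_simp

end Estimator

end FBMVolatility

end

theorem theorem1 {Ω : Type*} {mΩ : MeasurableSpace Ω} (P : Measure Ω) [IsProbabilityMeasure P]
    (H : ℝ) (hH₀ : 0 < H) (hH₁ : H < 3 / 4)
    (T : ℝ≥0) (hT : 0 < T) (σ s₀ : ℝ) (hσ : σ ≠ 0) (hs₀ : 0 < s₀)
    (B S : ℝ≥0 → Ω → ℝ)
    (hB : FBMVolatility.IsFractionalBrownianMotion H B P)
    (hS : FBMVolatility.IsStockPrice B P T σ s₀ S) :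
    ∃ v : ℝ≥0,
      HasSum (fun k : ℤ => 2 * σ ^ 4 * FBMVolatility.incrementCorr H k ^ 2) (v : ℝ) ∧
      Tendsto (fun N : ℕ => 2 * σ ^ 4 *
          (1 + 2 * (1 - 1 / (N : ℝ)) * ((2 : ℝ) ^ (2 * H - 1) - 1) ^ 2 +
            1 / 2 * ∑ k ∈ Finset.Icc 2 N, (1 - (k : ℝ) / N) *
              (((k : ℝ) + 1) ^ (2 * H) + ((k : ℝ) - 1) ^ (2 * H) - 2 * (k : ℝ) ^ (2 * H)) ^ 2))
        atTop (𝓝 (v : ℝ)) ∧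
      TendstoInDistribution
        (fun (N : ℕ) ω => √(N : ℝ) * (FBMVolatility.volEstimator H T S N ω - σ ^ 2))
        atTop (id : ℝ → ℝ) (fun _ => P) (gaussianReal 0 v) := by
  have hsum := FBMVolatility.summable_incrementCorr_sq hH₀ hH₁
  set w : ℝ≥0 := NNReal.mk (∑' k : ℤ, FBMVolatility.incrementCorr H k ^ 2)
    (tsum_nonneg fun _ => sq_nonneg _)
  have hwc : (w : ℝ) = ∑' k : ℤ, FBMVolatility.incrementCorr H k ^ 2 := rfl
  set v : ℝ≥0 := NNReal.mk ((σ ^ 2) ^ 2) (sq_nonneg _) * (2 * w) with hv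
  have hvc : (v : ℝ) = 2 * σ ^ 4 * ∑' k : ℤ, FBMVolatility.incrementCorr H k ^ 2 := by
    rw [hv, NNReal.coe_mul, NNReal.coe_mul, hwc, NNReal.coe_mk, NNReal.coe_ofNat]
    ring
  refine ⟨v, ?_, ?_, ?_⟩
  · rw [hvc]
    exact hsum.hasSum.mul_left _
  · rw [hvc]
    exact (FBMVolatility.tendsto_variance_formula hH₀ hH₁).const_mul _
  · have hrho : ∀ k, FBMVolatility.incrementCorr H (-k) ^ 2 =
        FBMVolatility.incrementCorr H k ^ 2 := fun k => by
      rw [FBMVolatility.incrementCorr_neg]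
    -- for `N = 0` the step `T / N` is `0`, but then there are no increments
    have hclt := FBMVolatility.tendstoInDistribution_sum_sq (P := P)
      (X := fun N i => FBMVolatility.normIncrement H B (T / N) i)
      (R := fun N => fun i j : Fin N => FBMVolatility.incrementCorr H ((i : ℤ) - j))
      (fun N => hB.hasGaussianLaw_normIncrement (T / N) N)
      (fun N i => hB.integral_normIncrement (T / N) i)
      (fun N i j => hB.covariance_normIncrement
        (div_pos hT (by exact_mod_cast i.pos)) i j) (w := w)
      (FBMVolatility.tendsto_toeplitz_sum_div (fun k => FBMVolatility.incrementCorr H k ^ 2) hrho hsum)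
      (fun ε hε => by
        obtain ⟨K, hK⟩ := FBMVolatility.exists_toeplitz_row_le (FBMVolatility.incrementCorr H) hsum hε
        exact ⟨K, fun N i => hK N i⟩)
    have hscaled := hclt.continuous_comp (continuous_const_mul (σ ^ 2))
    obtain ⟨hmem, hdrift⟩ :=
      FBMVolatility.tendstoInMeasure_driftError hB hH₀ hH₁ hT σ
    have hall := hscaled.add_of_tendstoInMeasure_const hdrift
      fun N => (hmem N).1.aemeasurable
    have hlimit : (gaussianReal 0 v).map id = (gaussianReal 0 (2 * w)).map (σ ^ 2 * ·) := by
      rw [Measure.map_id, gaussianReal_map_const_mul, mul_zero]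
    have hstat := hall.congr (Y := fun (N : ℕ) ω =>
        √(N : ℝ) * (FBMVolatility.volEstimator H T S N ω - σ ^ 2)) (T := (σ ^ 2 * ·))
      (fun N => by
        filter_upwards [hS.volEstimator_ae_eq hB hH₀ hT hs₀ N] with ω hω
        rw [hω]
        simp [FBMVolatility.incrementCorr_zero hH₀])
      (Eventually.of_forall fun x => by simp)
    refine ⟨hstat.forall_aemeasurable, aemeasurable_id, ?_⟩
    have e : (⟨(gaussianReal 0 v).map id, Measure.isProbabilityMeasure_map aemeasurable_id⟩ :
        ProbabilityMeasure ℝ) = ⟨(gaussianReal 0 (2 * w)).map (σ ^ 2 * ·),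
          Measure.isProbabilityMeasure_map hstat.aemeasurable_limit⟩ := Subtype.ext hlimit
    rw [e]
    exact hstat.tendsto
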